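/- Let $d\ge 1$, $0<s<1$, $0<g_*\le g^*$, and let $\Omega\subset\mathbb{R}^d$ be bounded and open (for instance a bounded Lipschitz domain). Let $g=g(x,y,r)>0$ be Borel measurable on $\mathbb{R}^d\times\mathbb{R}^d\times(0,\infty)$ and such that, for a.e. $(x,y)$, and also at $(x,x)$ for a.e. $x$: $g(x,y,\cdot)$ is locally Lipschitz on $(0,\infty)$, $\lim_{r\to0^+}r\,g(x,y,r)=0$, $\lim_{r\to\infty}r\,g(x,y,r)=\infty$, and $$g_*\le \frac{r\,\partial_r g(x,y,r)}{g(x,y,r)}+1\le g^*\qquad\text{for a.e. } r>0 .$$ Put $G(x,y,r)=\int_0^r g(x,y,\rho)\rho\,d\rho$, $\hat G(x,r)=G(x,x,r)$, $\delta^su(x,y)=\frac{u(x)-u(y)}{|x-y|^s}$ and $$\Gamma_{\hat G}(u)=\int_{\mathbb{R}^d}\hat G(x,|u(x)|)\,dx,\qquad \Gamma_{s,G}(u)=\iint_{\mathbb{R}^d\times\mathbb{R}^d}G(x,y,|\delta^su(x,y)|)\frac{dx\,dy}{|x-y|^d}.$$ Let $W^{s,G}(\mathbb{R}^d)$ be the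 space of measurable $u$ (modulo equality a.e.) with $\Gamma_{\hat G}(u)<\infty$ and $\Gamma_{s,G}(u)<\infty$, with norm $\|u\|_{s,G}=\inf\{\lambda>0:\Gamma_{\hat G}(u/\lambda)\le1\}+\inf\{\lambda>0:\Gamma_{s,G}(u/\lambda)\le1\}$. Assume that $C_c^\infty(\Omega)\subset W^{s,G}(\mathbb{R}^d)$ and $\int_\Omega\hat G(x,1)\,dx<\infty$ (both hold, for instance, if $G(x,y,1)$ is bounded), and let $W^{s,G}_0(\Omega)$ be the closure of $C_c^\infty(\Omega)$ in $W^{s,G}(\mathbb{R}^d)$. For $u,v\in W_0^{s,G}(\Omega)$ put $$\langle\mathcal{L}_g^su,v\rangle=\iint_{\mathbb{R}^d\times\mathbb{R}^d}g(x,y,|\delta^su|)\,\delta^su\,\delta^sv\,\frac{dx\,dy}{|x-y|^d}.$$ For $E\subset\Omega$, $u\in W^{s,G}_0(\Omega)$ and $c\in\mathbb{R}$ write $u\succeq c$ (respectively $u\preceq c$) on $E$ if there are Lipschitz functions $u_k$ with compact support in $\Omega$, $u_k\ge c$ (respectively $u_k\le c$) on $E$, with $u_k\to u$ in $W_0^{s,G}(\Omega)$;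 and say that $u=c$ on $E$ in the sense of $W_0^{s,G}(\Omega)$ if both $u\succeq c$ and $u\preceq c$ on $E$. Then the integral defining $\langle\mathcal{L}_g^su,v\rangle$ converges absolutely for all $u,v\in W^{s,G}_0(\Omega)$, and for every compact $E\subset\Omega$, with $\mathbb{K}^s_E=\{v\in W_0^{s,G}(\Omega):v\succeq1\text{ on }E\}$, the variational inequality $$u\in\mathbb{K}_E^s:\qquad\langle\mathcal{L}_g^su,v-u\rangle\ge0\quad\forall v\in\mathbb{K}_E^s$$ has a unique solution $u$ (up to equality a.e.), called the $(s,G)$-capacitary potential of $E$; the number $C_s^g(E):=\langle\mathcal{L}_g^su,u\rangle$ is called the $(s,G)$-capacity of $E$. Moreover: 1. $u=1$ on $E$ in the sense of $W^{s,G}_0(\Omega)$; 2. $\mathcal{L}_g^su\ge0$, i.e. $\langle\mathcal{L}_g^su,v\rangle\ge0$ for every $v\in W_0^{s,G}(\Omega)$ with $v\ge0$ a.e.; 3. $\mathcal{L}_g^su$ is given by a non-negative Radon measure $\mu$, i.e. $\langle\mathcal{L}_g^su,\varphi\rangle=\int\varphi\,d\mu$ for all $\varphi\in C_c^\infty(\Omega)$,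 with $\operatorname{supp}\mu\subset E$, and $$C_s^g(E)=\langle\mathcal{L}_g^su,u\rangle=\int_\Omega d\mu=\mu(E).$$ -/

import Mathlib

open MeasureTheory Filter Topology Set
open scoped ENNReal ContDiff

noncomputable section

namespace FracOrlicz

/-- `ℝᵈ` with the Euclidean norm and Lebesgue measure. -/
abbrev Space (d : ℕ) : Type := EuclideanSpace ℝ (Fin d)

/-- The conditions on one function `r ↦ g(x, y, r)`, `r > 0`: positivity, local Lipschitz
continuity, the limits of `r g(x, y, r)` at `0⁺` and at `+∞`, and the growth condition
`g_* ≤ r g'(x, y, r) / g(x, y, r) + 1 ≤ g^*`, where the derivative in `r` of the Lipschitz function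
exists for almost every `r > 0`. -/
structure IsAdmissible (gl gu : ℝ) (h : ℝ → ℝ) : Prop where
  pos : ∀ r : ℝ, 0 < r → 0 < h r
  lipschitz : LocallyLipschitzOn (Ioi (0 : ℝ)) h
  tendsto_zero : Tendsto (fun r : ℝ => r * h r) (𝓝[>] 0) (𝓝 0)
  tendsto_top : Tendsto (fun r : ℝ => r * h r) atTop atTop
  growth : ∀ᵐ r : ℝ, 0 < r → gl ≤ r * deriv h r / h r + 1 ∧ r * deriv h r / h r + 1 ≤ gu

variable {d : ℕ}

/-- `G(x, y, r) = ∫₀ʳ g(x, y, ρ) ρ dρ`. -/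
def primitiveG (g : Space d → Space d → ℝ → ℝ) (x y : Space d) (r : ℝ) : ℝ :=
  ∫ ρ in (0 : ℝ)..r, g x y ρ * ρ

/-- The difference quotient `δˢu(x, y) = (u(x) - u(y)) / |x - y|ˢ`. -/
def diffQuot (s : ℝ) (u : Space d → ℝ) (x y : Space d) : ℝ :=
  (u x - u y) / ‖x - y‖ ^ s

/-- The modular `∫ Ĝ(x, |u(x)|) dx`, where `Ĝ(x, r) = G(x, x, r)`. -/
def modularHat (g : Space d → Space d → ℝ → ℝ) (u : Space d → ℝ) : ℝ≥0∞ :=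
  ∫⁻ x : Space d, ENNReal.ofReal (primitiveG g x x |u x|)

/-- The modular `∫∫ G(x, y, |δˢu(x, y)|) dx dy / |x - y|ᵈ`. -/
def modularFrac (g : Space d → Space d → ℝ → ℝ) (s : ℝ) (u : Space d → ℝ) : ℝ≥0∞ :=
  ∫⁻ z : Space d × Space d,
    ENNReal.ofReal (primitiveG g z.1 z.2 |diffQuot s u z.1 z.2| / ‖z.1 - z.2‖ ^ d)

/-- The Luxemburg functional `inf {t > 0 : Γ(u / t) ≤ 1}` of a modular `Γ` (`∞` if there is no such
`t`). -/
def luxemburg (Γ : (Space d → ℝ) → ℝ≥0∞) (u : Space d → ℝ) : ℝ≥0∞ :=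
  ⨅ t : ℝ, ⨅ _ : 0 < t ∧ Γ (fun x => u x / t) ≤ 1, ENNReal.ofReal t

/-- The norm `‖u‖_{s,G} = ‖u‖_G + [u]_{s,G}` of `W^{s,G}(ℝᵈ)`. -/
def normW (g : Space d → Space d → ℝ → ℝ) (s : ℝ) (u : Space d → ℝ) : ℝ≥0∞ :=
  luxemburg (modularHat g) u + luxemburg (modularFrac g s) u

/-- `u ∈ W^{s,G}(ℝᵈ)`; functions are representatives of classes modulo equality a.e. -/
def MemW (g : Space d → Space d → ℝ → ℝ) (s : ℝ) (u : Space d → ℝ) : Prop :=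
  AEMeasurable u ∧ modularHat g u < ⊤ ∧ modularFrac g s u < ⊤

/-- `φ ∈ C_c^∞(Ω)`, extended by zero. -/
def IsTest (Ω : Set (Space d)) (φ : Space d → ℝ) : Prop :=
  ContDiff ℝ ∞ φ ∧ HasCompactSupport φ ∧ tsupport φ ⊆ Ω

/-- Lipschitz functions with compact support in `Ω`, extended by zero. -/
def IsLipTest (Ω : Set (Space d)) (φ : Space d → ℝ) : Prop :=
  (∃ K, LipschitzWith K φ) ∧ HasCompactSupport φ ∧ tsupport φ ⊆ Ω

/-- `u ∈ W₀^{s,G}(Ω)`, the closure of `C_c^∞(Ω)` in the norm of `W^{s,G}(ℝᵈ)`. -/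
def MemW0 (g : Space d → Space d → ℝ → ℝ) (s : ℝ) (Ω : Set (Space d)) (u : Space d → ℝ) : Prop :=
  MemW g s u ∧ ∃ φ : ℕ → Space d → ℝ, (∀ k, IsTest Ω (φ k)) ∧
    Tendsto (fun k => normW g s (fun x => φ k x - u x)) atTop (𝓝 0)

/-- `u ⪰ c` on `E` in the sense of `W₀^{s,G}(Ω)`. -/
def GeOn (g : Space d → Space d → ℝ → ℝ) (s : ℝ) (Ω E : Set (Space d)) (u : Space d → ℝ) (c : ℝ) :
    Prop :=
  ∃ w : ℕ → Space d → ℝ, (∀ k, IsLipTest Ω (w k) ∧ ∀ x ∈ E, c ≤ w k x) ∧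
    Tendsto (fun k => normW g s (fun x => w k x - u x)) atTop (𝓝 0)

/-- `u ⪯ c` on `E` in the sense of `W₀^{s,G}(Ω)`. -/
def LeOn (g : Space d → Space d → ℝ → ℝ) (s : ℝ) (Ω E : Set (Space d)) (u : Space d → ℝ) (c : ℝ) :
    Prop :=
  ∃ w : ℕ → Space d → ℝ, (∀ k, IsLipTest Ω (w k) ∧ ∀ x ∈ E, w k x ≤ c) ∧
    Tendsto (fun k => normW g s (fun x => w k x - u x)) atTop (𝓝 0)

/-- `u = c` on `E` in the sense of `W₀^{s,G}(Ω)`. -/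
def EqOn (g : Space d → Space d → ℝ → ℝ) (s : ℝ) (Ω E : Set (Space d)) (u : Space d → ℝ) (c : ℝ) :
    Prop :=
  GeOn g s Ω E u c ∧ LeOn g s Ω E u c

/-- The integrand of `⟨𝓛_g^s u, v⟩`. -/
def integrandL (g : Space d → Space d → ℝ → ℝ) (s : ℝ) (u v : Space d → ℝ)
    (z : Space d × Space d) : ℝ :=
  g z.1 z.2 |diffQuot s u z.1 z.2| * diffQuot s u z.1 z.2 * diffQuot s v z.1 z.2 / ‖z.1 - z.2‖ ^ d

/-- The duality `⟨𝓛_g^s u, v⟩`. -/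
def pairingL (g : Space d → Space d → ℝ → ℝ) (s : ℝ) (u v : Space d → ℝ) : ℝ :=
  ∫ z : Space d × Space d, integrandL g s u v z

/-- The convex set `𝕂_E = {v ∈ W₀^{s,G}(Ω) : v ⪰ 1 on E}`. -/
def MemK (g : Space d → Space d → ℝ → ℝ) (s : ℝ) (Ω E : Set (Space d)) (v : Space d → ℝ) : Prop :=
  MemW0 g s Ω v ∧ GeOn g s Ω E v 1

/-- `u` is an `(s,G)`-capacitary potential of `E`: it solves the variational inequality
`u ∈ 𝕂_E`, `⟨𝓛_g^s u, v - u⟩ ≥ 0` for all `v ∈ 𝕂_E`. -/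
def IsCapacitaryPotential (g : Space d → Space d → ℝ → ℝ) (s : ℝ) (Ω E : Set (Space d))
    (u : Space d → ℝ) : Prop :=
  MemK g s Ω E u ∧ ∀ v, MemK g s Ω E v → 0 ≤ pairingL g s u (fun x => v x - u x)

open Classical in
/-- The `(s,G)`-capacity `C_s^g(E)`: the number `⟨𝓛_g^s u, u⟩` for the capacitary potential `u` of
`E` (and `0` by convention if there were none). -/
def capacity (g : Space d → Space d → ℝ → ℝ) (s : ℝ) (Ω E : Set (Space d)) : ℝ :=
  if h : ∃ u, IsCapacitaryPotential g s Ω E u then pairingL g s h.choose h.choose else 0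

end FracOrlicz

end

/-! ### Young functions with power growth. -/

noncomputable section

namespace FracOrlicz

/-! The potential is the minimizer of the convex energy `modularFrac` over `𝕂_E`; the variational
inequality is its first variation. Integrating the growth condition gives two-sided power bounds for
`r g(x, y, r)` (`IsAdmissible.toGrowth`), uniform in `(x, y)`, and everything analytic follows from
these: the doubling property, a Young-type bound that makes the pairing absolutely convergent, and
uniform convexity of the energy (`exists_uniformConvexity`). By doubling, convergence in the
Luxemburg norm is the same as convergence of both modulars (`tendsto_normW_iff`), so norms are left
behind at once and neither duality nor weak compactness is needed.

Existence: the energy is minimized over Lipschitz test functions that are at least `1` on `E`.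
Truncation to `[0, 1]` does not increase it, and uniform convexity makes a minimizing sequence
Cauchy for the energy (`cauchy_of_minimizing`). The energy sees only differences `u(x) - u(y)`, but
all functions vanish outside the bounded set `Ω`; choosing `y` there turns convergence of
differences into convergence a.e. The truncation bound together with `∫_Ω Ĝ(x, 1) dx < ∞` then gives
convergence of the zero-order modular by dominated convergence, in place of a Poincaré inequality.
The infimum over Lipschitz functions is also a lower bound on `𝕂_E`, by passing to limits
(`le_modular_of_tendsto`). The truncated sequence equals `1` on `E`, which gives item 1.

Uniqueness is strict monotonicity of `r ↦ g(x, y, |r|) r`. For item 2, `u + v` competes in `𝕂_E`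
whenever `v` is a limit of Lipschitz functions that are non-negative on `E`; positive parts of
approximants supply these if `v ≥ 0`. Since only the sign on `E` matters, the functional is
non-negative on the cone of functions non-negative on `E`. The M. Riesz extension theorem for this
cone and the Riesz–Markov theorem then produce a measure carried by `E`
(`exists_measure_of_nonneg_on`). Finally `⟨𝓛u, u⟩ = ⟨𝓛u, χ⟩` for every test function `χ` equal to
`1` on `E` (`pairingL_self_eq`), and the right side is `μ(E)`. -/

/-- Two-sided power growth of `r ↦ r h(r)`, the integrated form of the bounds
`p ≤ r h'(r) / h(r) + 1 ≤ q`. -/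
structure Growth (p q : ℝ) (h : ℝ → ℝ) : Prop where
  pos : ∀ r : ℝ, 0 < r → 0 < h r
  cont : ContinuousOn h (Ioi 0)
  lower : ∀ r t : ℝ, 0 < r → r ≤ t → r * h r * (t / r) ^ p ≤ t * h t
  upper : ∀ r t : ℝ, 0 < r → r ≤ t → t * h t ≤ r * h r * (t / r) ^ q

/-- The function is `r h(r) / r ^ c`, whose monotonicity encodes a power bound. Absolute continuity
lets the sign of its a.e. derivative be integrated. -/
lemma LocallyLipschitzOn.absolutelyContinuous_mul_rpow {h : ℝ → ℝ}
    (hl : LocallyLipschitzOn (Ioi (0 : ℝ)) h) (c : ℝ) {r t : ℝ} (hr : 0 < r) (hrt : r ≤ t) :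
    AbsolutelyContinuousOnInterval (fun x => h x * x ^ (1 - c)) r t := by
  have hsub : uIcc r t ⊆ Ioi 0 := by
    rw [uIcc_of_le hrt]
    exact fun x hx => hr.trans_le hx.1
  obtain ⟨K, hK⟩ := (hl.mono hsub).exists_lipschitzOnWith_of_compact isCompact_uIcc
  have h2 : AbsolutelyContinuousOnInterval (fun x : ℝ => x ^ (1 - c)) r t := by
    refine ContDiffOn.absolutelyContinuousOnInterval fun x hx => ?_
    exact (Real.contDiffAt_rpow_const_of_ne (hsub hx).ne').contDiffWithinAt
  exact hK.absolutelyContinuousOnInterval.mul h2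

lemma ae_deriv_mul_rpow {h : ℝ → ℝ} (hpos : ∀ r : ℝ, 0 < r → 0 < h r)
    (hl : LocallyLipschitzOn (Ioi (0 : ℝ)) h) (c : ℝ) {r t : ℝ} (hr : 0 < r) (hrt : r ≤ t) :
    ∀ᵐ x : ℝ, x ∈ uIcc r t → deriv (fun x => h x * x ^ (1 - c)) x =
      h x * x ^ (-c) * (x * deriv h x / h x + 1 - c) := by
  have hsub : uIcc r t ⊆ Ioi 0 := by
    rw [uIcc_of_le hrt]
    exact fun x hx => hr.trans_le hx.1
  obtain ⟨K, hK⟩ := (hl.mono hsub).exists_lipschitzOnWith_of_compact isCompact_uIcc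
  filter_upwards [hK.absolutelyContinuousOnInterval.ae_differentiableAt] with x hx hxm
  have hx0 : 0 < x := hsub hxm
  have hd := (hx hxm).hasDerivAt.mul (Real.hasDerivAt_rpow_const (p := 1 - c) (Or.inl hx0.ne'))
  refine hd.deriv.trans ?_
  have e1 : x ^ (1 - c) = x * x ^ (-c) := by
    rw [show (1 - c) = 1 + -c by ring, Real.rpow_add hx0, Real.rpow_one]
  have e2 : (1 - c - 1) = -c := by ring
  rw [e2, e1]
  have := (hpos x hx0).ne'
  field_simp
  ring

/-- The derivative of `r h(r) / r ^ c` has the sign of `r h'(r) / h(r) + 1 - c`, so the quotient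
increases for `c = gl` and decreases for `c = gu`. -/
lemma IsAdmissible.toGrowth {gl gu : ℝ} {h : ℝ → ℝ} (H : IsAdmissible gl gu h) :
    Growth gl gu h := by
  have key : ∀ c r t : ℝ, 0 < r → r ≤ t →
      (r * h r * (t / r) ^ c = t ^ c * (h r * r ^ (1 - c))) ∧
      t * h t = t ^ c * (h t * t ^ (1 - c)) := by
    intro c r t hr hrt
    have ht := hr.trans_le hrt
    rw [Real.div_rpow ht.le hr.le, Real.rpow_sub hr, Real.rpow_sub ht, Real.rpow_one, Real.rpow_one]
    have := (Real.rpow_pos_of_pos hr c).ne'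
    have := (Real.rpow_pos_of_pos ht c).ne'
    constructor <;> field_simp
  refine ⟨H.pos, H.lipschitz.continuousOn, fun r t hr hrt => ?_, fun r t hr hrt => ?_⟩
  · rw [(key gl r t hr hrt).1, (key gl r t hr hrt).2]
    refine mul_le_mul_of_nonneg_left ?_ (Real.rpow_nonneg (hr.le.trans hrt) _)
    have hac := LocallyLipschitzOn.absolutelyContinuous_mul_rpow H.lipschitz gl hr hrt
    rw [← sub_nonneg, ← hac.integral_deriv_eq_sub]
    refine intervalIntegral.integral_nonneg_of_ae_restrict hrt ?_
    refine (ae_restrict_iff' measurableSet_Icc).2 ?_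
    filter_upwards [ae_deriv_mul_rpow H.pos H.lipschitz gl hr hrt, H.growth] with x h1 h2 hx
    have hx0 : 0 < x := hr.trans_le hx.1
    rw [h1 (by rwa [uIcc_of_le hrt])]
    have := (h2 hx0).1
    exact mul_nonneg (mul_nonneg (H.pos x hx0).le (Real.rpow_nonneg hx0.le _)) (by linarith)
  · rw [(key gu r t hr hrt).1, (key gu r t hr hrt).2]
    refine mul_le_mul_of_nonneg_left ?_ (Real.rpow_nonneg (hr.le.trans hrt) _)
    have hac := LocallyLipschitzOn.absolutelyContinuous_mul_rpow H.lipschitz gu hr hrt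
    rw [← sub_nonneg, ← neg_sub, ← hac.integral_deriv_eq_sub, ← intervalIntegral.integral_neg]
    refine intervalIntegral.integral_nonneg_of_ae_restrict hrt ?_
    refine (ae_restrict_iff' measurableSet_Icc).2 ?_
    filter_upwards [ae_deriv_mul_rpow H.pos H.lipschitz gu hr hrt, H.growth] with x h1 h2 hx
    have hx0 : 0 < x := hr.trans_le hx.1
    rw [Pi.zero_apply, h1 (by rwa [uIcc_of_le hrt]), ← mul_neg]
    have := (h2 hx0).2
    exact mul_nonneg (mul_nonneg (H.pos x hx0).le (Real.rpow_nonneg hx0.le _)) (by linarith)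

lemma Growth.div_const {p q : ℝ} {h : ℝ → ℝ} (H : Growth p q h) {c : ℝ} (hc : 0 < c) :
    Growth p q (fun r => h r / c) := by
  refine ⟨fun r hr => div_pos (H.pos r hr) hc, H.cont.div_const c, fun r t hr hrt => ?_,
    fun r t hr hrt => ?_⟩
  · have := H.lower r t hr hrt
    calc r * (h r / c) * (t / r) ^ p = r * h r * (t / r) ^ p / c := by ring
      _ ≤ t * h t / c := by gcongr
      _ = t * (h t / c) := by ring
  · have := H.upper r t hr hrt
    calc t * (h t / c) = t * h t / c := by ring
      _ ≤ r * h r * (t / r) ^ q / c := by gcongr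
      _ = r * (h r / c) * (t / r) ^ q := by ring

/-- The odd field `r ↦ h(|r|) r`. -/
def field (h : ℝ → ℝ) (r : ℝ) : ℝ := h |r| * r

/-- The even Young function `r ↦ ∫₀^{|r|} h(ρ) ρ dρ`. -/
def young (h : ℝ → ℝ) (r : ℝ) : ℝ := ∫ ρ in (0 : ℝ)..|r|, h ρ * ρ

lemma field_neg (h : ℝ → ℝ) (r : ℝ) : field h (-r) = -field h r := by simp [field]

lemma field_zero (h : ℝ → ℝ) : field h 0 = 0 := by simp [field]

lemma young_zero (h : ℝ → ℝ) : young h 0 = 0 := by simp [young]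

lemma young_abs (h : ℝ → ℝ) (r : ℝ) : young h |r| = young h r := by simp [young]

lemma young_neg (h : ℝ → ℝ) (r : ℝ) : young h (-r) = young h r := by simp [young]

lemma field_of_nonneg (h : ℝ → ℝ) {r : ℝ} (hr : 0 ≤ r) : field h r = r * h r := by
  rw [field, abs_of_nonneg hr, mul_comm]

lemma young_eq_integral_field (h : ℝ → ℝ) (r : ℝ) : young h r = ∫ ρ in (0 : ℝ)..r, field h ρ := by
  have main : ∀ r : ℝ, 0 ≤ r → young h r = ∫ ρ in (0 : ℝ)..r, field h ρ := by
    intro r hr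
    rw [young, abs_of_nonneg hr]
    refine intervalIntegral.integral_congr fun x hx => ?_
    rw [uIcc_of_le hr] at hx
    simp only [field, abs_of_nonneg hx.1]
  rcases le_total 0 r with hr | hr
  · exact main r hr
  · rw [← young_neg, main (-r) (by linarith)]
    have := intervalIntegral.integral_comp_neg (a := 0) (b := r) (fun ρ => field h ρ)
    rw [neg_zero] at this
    rw [intervalIntegral.integral_symm, ← this]
    simp only [field_neg, intervalIntegral.integral_neg, neg_neg]

namespace Growth

variable {p q : ℝ} {h : ℝ → ℝ}

lemma field_nonneg (H : Growth p q h) {r : ℝ} (hr : 0 ≤ r) : 0 ≤ field h r := by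
  rcases hr.eq_or_lt with rfl | hr
  · simp [field]
  · rw [field_of_nonneg h hr.le]
    exact (mul_pos hr (H.pos r hr)).le

lemma field_pos (H : Growth p q h) {r : ℝ} (hr : 0 < r) : 0 < field h r := by
  rw [field_of_nonneg h hr.le]
  exact mul_pos hr (H.pos r hr)

lemma field_mul_le (H : Growth p q h) {c r : ℝ} (hc : 1 ≤ c) (hr : 0 ≤ r) :
    field h (c * r) ≤ c ^ q * field h r := by
  rcases hr.eq_or_lt with rfl | hr
  · simp [field]
  · have hc0 : 0 < c := by linarith
    have := H.upper r (c * r) hr (le_mul_of_one_le_left hr.le hc)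
    rw [mul_div_cancel_right₀ _ hr.ne'] at this
    rw [field_of_nonneg h hr.le, field_of_nonneg h (by positivity)]
    linarith

lemma field_mul_le_of_le_one (H : Growth p q h) {c r : ℝ} (hc0 : 0 < c) (hc : c ≤ 1)
    (hr : 0 ≤ r) : field h (c * r) ≤ c ^ p * field h r := by
  rcases hr.eq_or_lt with rfl | hr
  · simp [field]
  · have := H.lower (c * r) r (by positivity) (mul_le_of_le_one_left hr.le hc)
    have e : (r / (c * r)) ^ p = (c ^ p)⁻¹ := by
      rw [← Real.inv_rpow hc0.le]
      congr 1
      field_simp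
    rw [e] at this
    have hcp := Real.rpow_pos_of_pos hc0 p
    rw [field_of_nonneg h hr.le, field_of_nonneg h (by positivity)]
    rw [← div_eq_mul_inv, div_le_iff₀ hcp] at this
    linarith

lemma strictMono_field (H : Growth p q h) (hp : 0 < p) : StrictMono (field h) := by
  refine strictMono_of_odd_strictMonoOn_nonneg (field_neg h) ?_
  intro a ha b hb hab
  rcases (show (0 : ℝ) ≤ a from ha).eq_or_lt with rfl | ha
  · rw [field_zero]
    exact H.field_pos hab
  · have hb0 : 0 < b := ha.trans hab
    have h1 := H.field_mul_le_of_le_one (c := a / b) (r := b) (by positivity)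
      ((div_le_one hb0).2 hab.le) hb0.le
    rw [div_mul_cancel₀ _ hb0.ne'] at h1
    refine h1.trans_lt ?_
    have : (a / b) ^ p < 1 := Real.rpow_lt_one (by positivity) ((div_lt_one hb0).2 hab) hp
    exact mul_lt_of_lt_one_left (H.field_pos hb0) this

/-- Only the origin needs an argument: there `|field h r| ≤ |r| ^ p * field h 1`, which tends to
zero because `p > 0`. -/
lemma continuous_field (H : Growth p q h) (hp : 0 < p) : Continuous (field h) := by
  rw [continuous_iff_continuousAt]
  intro r
  rcases eq_or_ne r 0 with rfl | hr
  · rw [ContinuousAt, field_zero]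
    have hbound : ∀ᶠ r in 𝓝 (0 : ℝ), ‖field h r‖ ≤ |r| ^ p * field h 1 := by
      have : Ioo (-1 : ℝ) 1 ∈ 𝓝 (0 : ℝ) := Ioo_mem_nhds (by norm_num) (by norm_num)
      filter_upwards [this] with r hr
      have h1 : ‖field h r‖ = field h |r| := by
        rw [Real.norm_eq_abs, field_of_nonneg h (abs_nonneg r), field, abs_mul]
        rcases eq_or_ne r 0 with rfl | hr
        · simp
        · rw [abs_of_pos (H.pos _ (abs_pos.2 hr)), mul_comm]
      rw [h1]
      rcases eq_or_ne r 0 with rfl | hr0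
      · simp [field_zero, Real.zero_rpow hp.ne']
      · have := H.field_mul_le_of_le_one (c := |r|) (r := 1) (abs_pos.2 hr0)
          (abs_le.2 ⟨hr.1.le, hr.2.le⟩) zero_le_one
        rwa [mul_one] at this
    refine squeeze_zero_norm' hbound ?_
    have : Tendsto (fun r : ℝ => |r| ^ p * field h 1) (𝓝 0) (𝓝 (|(0 : ℝ)| ^ p * field h 1)) :=
      ((continuous_abs.tendsto 0).rpow_const (Or.inr hp.le)).mul_const _
    simpa [Real.zero_rpow hp.ne'] using this
  · have h1 : ContinuousAt h |r| := H.cont.continuousAt (Ioi_mem_nhds (abs_pos.2 hr))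
    exact (ContinuousAt.comp (f := fun r : ℝ => |r|) h1 continuous_abs.continuousAt).mul
      continuousAt_id

lemma young_sub_young (H : Growth p q h) (hp : 0 < p) (a b : ℝ) :
    young h b - young h a = ∫ ρ in a..b, field h ρ := by
  rw [young_eq_integral_field, young_eq_integral_field]
  exact intervalIntegral.integral_interval_sub_left
    ((H.continuous_field hp).intervalIntegrable _ _)
    ((H.continuous_field hp).intervalIntegrable _ _)

/-- The gradient inequality for the convex function `young h`. -/
lemma field_mul_sub_le (H : Growth p q h) (hp : 0 < p) (a b : ℝ) :
    field h a * (b - a) ≤ young h b - young h a := by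
  have hm := (H.strictMono_field hp).monotone
  have hi := fun a b => (H.continuous_field hp).intervalIntegrable (μ := volume) a b
  rw [H.young_sub_young hp]
  rcases le_total a b with hab | hab
  · have := intervalIntegral.integral_mono_on hab (by simp) (hi a b)
      (fun x (hx : x ∈ Icc a b) => hm hx.1)
    simpa [mul_comm] using this
  · have := intervalIntegral.integral_mono_on hab (hi b a)
      (_root_.intervalIntegrable_const (c := field h a)) (fun x (hx : x ∈ Icc b a) => hm hx.2)
    rw [intervalIntegral.integral_symm]
    rw [intervalIntegral.integral_const, smul_eq_mul] at this
    linarith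

lemma continuous_young (H : Growth p q h) (hp : 0 < p) : Continuous (young h) := by
  have : young h = fun r => ∫ ρ in (0 : ℝ)..r, field h ρ := funext (young_eq_integral_field h)
  rw [this]
  exact intervalIntegral.continuous_primitive
    (fun a b => (H.continuous_field hp).intervalIntegrable a b) 0

lemma young_nonneg (H : Growth p q h) (hp : 0 < p) (r : ℝ) : 0 ≤ young h r := by
  have := H.field_mul_sub_le hp 0 r
  rw [field_zero, young_zero] at this
  linarith

lemma young_le_field_mul (H : Growth p q h) (hp : 0 < p) (r : ℝ) : young h r ≤ field h r * r := by
  have := H.field_mul_sub_le hp r 0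
  rw [young_zero] at this
  linarith

lemma young_mono (H : Growth p q h) (hp : 0 < p) {a b : ℝ} (hab : |a| ≤ |b|) :
    young h a ≤ young h b := by
  rw [← young_abs h a, ← young_abs h b]
  have := H.field_mul_sub_le hp |a| |b|
  have h2 := mul_nonneg (H.field_nonneg (abs_nonneg a)) (sub_nonneg.2 hab)
  linarith

lemma young_pos (H : Growth p q h) (hp : 0 < p) {r : ℝ} (hr : r ≠ 0) : 0 < young h r := by
  rw [← young_abs h r]
  have := H.field_mul_sub_le hp (|r| / 2) |r|
  have h2 := H.field_pos (half_pos (abs_pos.2 hr))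
  have h3 : 0 < field h (|r| / 2) * (|r| - |r| / 2) :=
    mul_pos h2 (by linarith [abs_pos.2 hr])
  have := H.young_nonneg hp (|r| / 2)
  linarith

/-- The doubling property. Substituting `ρ ↦ c ρ` in the integral contributes one factor `c`, and
the upper bound on the field contributes `c ^ q`. -/
lemma young_mul_le (H : Growth p q h) (hp : 0 < p) {c : ℝ} (hc : 1 ≤ c) (r : ℝ) :
    young h (c * r) ≤ c ^ (q + 1) * young h r := by
  have hc0 : 0 < c := by linarith
  rw [← young_abs, ← young_abs h r, abs_mul, abs_of_pos hc0, young_eq_integral_field,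
    young_eq_integral_field]
  have e := intervalIntegral.mul_integral_comp_mul_left (a := 0) (b := |r|) (f := field h) c
  rw [mul_zero] at e
  rw [← e, Real.rpow_add hc0, Real.rpow_one, mul_comm (c ^ q) c, mul_assoc,
    ← intervalIntegral.integral_const_mul (c ^ q)]
  refine mul_le_mul_of_nonneg_left ?_ hc0.le
  have hcont := H.continuous_field hp
  refine intervalIntegral.integral_mono_on (abs_nonneg r)
    ((hcont.comp (continuous_const.mul continuous_id)).intervalIntegrable _ _)
    ((continuous_const.mul hcont).intervalIntegrable _ _) fun x hx => H.field_mul_le hc hx.1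

/-- Weighted sum of the gradient inequalities based at the intermediate point, where the linear
terms cancel. -/
lemma young_convex (H : Growth p q h) (hp : 0 < p) {t : ℝ} (ht0 : 0 ≤ t) (ht1 : t ≤ 1) (a b : ℝ) :
    young h ((1 - t) * a + t * b) ≤ (1 - t) * young h a + t * young h b := by
  have h1 := H.field_mul_sub_le hp ((1 - t) * a + t * b) a
  have h2 := H.field_mul_sub_le hp ((1 - t) * a + t * b) b
  have h3 := mul_le_mul_of_nonneg_left h1 (sub_nonneg.2 ht1)
  have h4 := mul_le_mul_of_nonneg_left h2 ht0
  nlinarith [h3, h4]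

lemma young_mul_le_of_le_one (H : Growth p q h) (hp : 0 < p) {t : ℝ} (ht0 : 0 ≤ t) (ht1 : t ≤ 1)
    (r : ℝ) : young h (t * r) ≤ t * young h r := by
  have := H.young_convex hp ht0 ht1 0 r
  simpa [young_zero] using this

lemma young_add_le (H : Growth p q h) (hp : 0 < p) (a b : ℝ) :
    young h (a + b) ≤ 2 ^ (q + 1) * (young h a + young h b) := by
  have h1 := H.young_convex hp (t := 1 / 2) (by norm_num) (by norm_num) a b
  have h2 := H.young_mul_le hp (c := 2) (by norm_num) ((1 - 1 / 2) * a + 1 / 2 * b)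
  have e : 2 * ((1 - 1 / 2) * a + 1 / 2 * b) = a + b := by ring
  rw [e] at h2
  have h4 := H.young_nonneg hp a
  have h5 := H.young_nonneg hp b
  refine h2.trans (mul_le_mul_of_nonneg_left ?_ (by positivity))
  linarith

/-- The gradient inequality from `r / 2` to `r` bounds `field h (r / 2) * (r / 2)`, and doubling
compares `field h r` with `field h (r / 2)`. With this bound, pairings are controlled by the Young
function itself and no conjugate function is needed. -/
lemma field_mul_self_le (H : Growth p q h) (hp : 0 < p) (r : ℝ) :
    field h r * r ≤ 2 ^ (q + 1) * young h r := by
  have main : ∀ r : ℝ, 0 ≤ r → field h r * r ≤ 2 ^ (q + 1) * young h r := by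
    intro r hr
    have h1 := H.field_mul_sub_le hp (r / 2) r
    have h2 := H.field_mul_le (c := 2) (by norm_num) (show 0 ≤ r / 2 by linarith)
    rw [mul_div_cancel₀ r two_ne_zero] at h2
    have h3 := H.young_nonneg hp (r / 2)
    rw [Real.rpow_add two_pos, Real.rpow_one]
    have h4 : field h r * r ≤ 2 ^ q * field h (r / 2) * r := mul_le_mul_of_nonneg_right h2 hr
    have h5 : field h (r / 2) * r ≤ 2 * young h r := by linarith
    have h6 := mul_le_mul_of_nonneg_left h5 (Real.rpow_nonneg zero_le_two q)
    linarith
  rcases le_total 0 r with hr | hr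
  · exact main r hr
  · have := main (-r) (by linarith)
    rw [field_neg, young_neg] at this
    linarith

lemma abs_field (H : Growth p q h) (r : ℝ) : |field h r| = field h |r| := by
  rcases le_total 0 r with hr | hr
  · rw [abs_of_nonneg hr, abs_of_nonneg (H.field_nonneg hr)]
  · have := H.field_nonneg (neg_nonneg.2 hr)
    rw [abs_of_nonpos hr, field_neg, abs_of_nonpos (by rw [field_neg] at this; linarith)]

/-- A Young-type inequality. -/
lemma abs_field_mul_le (H : Growth p q h) (hp : 0 < p) {a b c : ℝ} (ha : |a| ≤ c) (hb : |b| ≤ c) :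
    |field h a * b| ≤ 2 ^ (q + 1) * young h c := by
  have hc : 0 ≤ c := (abs_nonneg a).trans ha
  rw [abs_mul, H.abs_field]
  refine le_trans ?_ (H.field_mul_self_le hp c)
  exact mul_le_mul ((H.strictMono_field hp).monotone ha) hb (abs_nonneg _) (H.field_nonneg hc)

/-- The convexity defect dominates the increment of the field over the middle half of the segment:
sum four gradient inequalities along `m`, `m ± k / 2`, `m ± k`; the terms with `field h m` cancel.
-/
lemma young_sub_le_of_field (H : Growth p q h) (hp : 0 < p) (m k : ℝ) :
    k / 2 * (field h (m + k / 2) - field h (m - k / 2)) ≤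
      young h (m + k) + young h (m - k) - 2 * young h m := by
  have h1 := H.field_mul_sub_le hp (m + k / 2) (m + k)
  have h2 := H.field_mul_sub_le hp m (m + k / 2)
  have h3 := H.field_mul_sub_le hp (m - k / 2) (m - k)
  have h4 := H.field_mul_sub_le hp m (m - k / 2)
  nlinarith

/-- Quantitative strict monotonicity of the field. -/
lemma le_field_sub_field (H : Growth p q h) (hp : 0 < p) {θ a b : ℝ} (hθ0 : 0 < θ) (hθ1 : θ < 1)
    (hab : b < a) (hd : θ * |a| ≤ a - b) (hd' : θ * |b| ≤ a - b) :
    (1 - (1 - θ) ^ p) * field h ((a - b) / 2) ≤ field h a - field h b := by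
  have hm := (H.strictMono_field hp).monotone
  have hc0 : 0 < (1 - θ) ^ p := Real.rpow_pos_of_pos (by linarith) p
  have hc1 : (1 - θ) ^ p ≤ 1 := Real.rpow_le_one (by linarith) (by linarith) hp.le
  -- When `a` has the larger modulus, `b ≤ (1 - θ) a`, so the lower power bound gives `field h b ≤
  -- (1 - θ) ^ p * field h a`. The other case reduces to this one by oddness.
  have main : ∀ a b : ℝ, b < a → |b| ≤ a → θ * a ≤ a - b →
      (1 - (1 - θ) ^ p) * field h ((a - b) / 2) ≤ field h a - field h b := by
    intro a b hab hba hd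
    obtain ⟨hb1, hb2⟩ := abs_le.1 hba
    have ha0 : 0 ≤ a := (abs_nonneg b).trans hba
    have h1 : field h b ≤ (1 - θ) ^ p * field h a := by
      refine le_trans (hm ?_) (H.field_mul_le_of_le_one (by linarith) (by linarith) ha0)
      linarith
    have h2 : field h ((a - b) / 2) ≤ field h a := hm (by linarith)
    have h3 := mul_le_mul_of_nonneg_left h2 (sub_nonneg.2 hc1)
    linarith
  rcases le_total |b| |a| with hba | hba
  · have ha : 0 ≤ a := by
      by_contra hcon
      push Not at hcon
      rw [abs_of_neg hcon, abs_of_neg (hab.trans hcon)] at hba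
      linarith
    rw [abs_of_nonneg ha] at hba hd
    exact main a b hab hba hd
  · have hb : b ≤ 0 := by
      by_contra hcon
      push Not at hcon
      rw [abs_of_pos hcon, abs_of_pos (hcon.trans hab)] at hba
      linarith
    rw [abs_of_nonpos hb] at hba hd'
    have := main (-b) (-a) (by linarith) (by rwa [abs_neg]) (by linarith)
    rw [field_neg, field_neg] at this
    have e : (-b - -a) / 2 = (a - b) / 2 := by ring
    rw [e] at this
    linarith

end Growth

/-! ### Uniform convexity. -/

/-- Uniform convexity of Young functions with given growth exponents. -/
lemma exists_uniformConvexity (p q : ℝ) (hp : 0 < p) {ε : ℝ} (hε : 0 < ε) :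
    ∃ C : ℝ, 0 ≤ C ∧ ∀ h, Growth p q h → ∀ a b : ℝ,
      young h (a - b) ≤ ε * (young h a + young h b) +
        C * (young h a + young h b - 2 * young h ((a + b) / 2)) := by
  -- The threshold `θ` separates close from distant pairs. It is chosen so that `4 θ ≤ ε` and `4 θ ≤
  -- 1`; it depends only on `ε`, hence `C` only on `ε`, `p`, `q`.
  set θ : ℝ := min (ε / 4) (1 / 4) with hθ
  have hθ0 : 0 < θ := by positivity
  have hθ4 : 4 * θ ≤ 1 := by have : θ ≤ 1 / 4 := min_le_right _ _; linarith
  have hθε : 4 * θ ≤ ε := by have : θ ≤ ε / 4 := min_le_left _ _; linarith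
  have hc : 0 < 1 - (1 - θ) ^ p := by
    have : (1 - θ) ^ p < 1 := Real.rpow_lt_one (by linarith) (by linarith) hp
    linarith
  refine ⟨4 ^ (q + 1) / (1 - (1 - θ) ^ p), by positivity, fun h H => ?_⟩
  have main : ∀ a b : ℝ, b ≤ a → young h (a - b) ≤ ε * (young h a + young h b) +
      4 ^ (q + 1) / (1 - (1 - θ) ^ p) *
        (young h a + young h b - 2 * young h ((a + b) / 2)) := by
    intro a b hab
    have ya := H.young_nonneg hp a
    have yb := H.young_nonneg hp b
    have hconv : 0 ≤ young h a + young h b - 2 * young h ((a + b) / 2) := by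
      have := H.young_convex hp (t := 1 / 2) (by norm_num) (by norm_num) a b
      have e : (1 - 1 / 2) * a + 1 / 2 * b = (a + b) / 2 := by ring
      rw [e] at this
      linarith
    -- Close pairs: `|a - b| ≤ 4 θ max(|a|, |b|)`, and convexity pulls out the factor `4 θ ≤ ε`.
    -- Distant pairs: the field increases by a definite amount between `m - k / 2` and `m + k / 2`,
    -- so the convexity defect controls `young h (k / 2)`, and doubling with `4 (k / 2) = a - b`
    -- concludes.
    by_cases hcase : a - b < 2 * θ * (|a| + |b|)
    · have h1 : young h (a - b) ≤ 4 * θ * young h (max |a| |b|) := by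
        refine le_trans (H.young_mono hp ?_)
          (H.young_mul_le_of_le_one hp (by positivity) hθ4 (max |a| |b|))
        rw [abs_of_nonneg (sub_nonneg.2 hab), abs_of_nonneg (by positivity)]
        have := le_max_left |a| |b|
        have := le_max_right |a| |b|
        nlinarith
      have h2 : young h (max |a| |b|) ≤ young h a + young h b := by
        rcases max_choice |a| |b| with e | e <;> rw [e, young_abs] <;> linarith
      have h3 : 4 * θ * young h (max |a| |b|) ≤ ε * (young h a + young h b) :=
        mul_le_mul hθε h2 (H.young_nonneg hp _) hε.le
      have h4 : 0 ≤ 4 ^ (q + 1) / (1 - (1 - θ) ^ p) *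
        (young h a + young h b - 2 * young h ((a + b) / 2)) := by positivity
      linarith
    · push Not at hcase
      rcases hab.eq_or_lt with rfl | hab
      · rw [sub_self, young_zero]
        positivity
      · set m := (a + b) / 2 with hm
        set k := (a - b) / 2 with hk
        have hk0 : 0 < k := by rw [hk]; linarith
        have ea : m + k = a := by rw [hm, hk]; ring
        have eb : m - k = b := by rw [hm, hk]; ring
        have h1 := H.young_sub_le_of_field hp m k
        rw [ea, eb] at h1
        have ek : m + k / 2 - (m - k / 2) = k := by ring
        have b1 : |m + k / 2| ≤ |a| + |b| := by
          have : m + k / 2 = 3 / 4 * a + 1 / 4 * b := by rw [hm, hk]; ring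
          rw [this]
          refine (abs_add_le _ _).trans ?_
          rw [abs_mul, abs_mul]
          norm_num
          linarith [abs_nonneg a, abs_nonneg b]
        have b2 : |m - k / 2| ≤ |a| + |b| := by
          have : m - k / 2 = 1 / 4 * a + 3 / 4 * b := by rw [hm, hk]; ring
          rw [this]
          refine (abs_add_le _ _).trans ?_
          rw [abs_mul, abs_mul]
          norm_num
          linarith [abs_nonneg a, abs_nonneg b]
        have hkθ : θ * (|a| + |b|) ≤ k := by rw [hk]; linarith
        have h2 := H.le_field_sub_field hp (θ := θ) (a := m + k / 2) (b := m - k / 2) hθ0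
          (by linarith) (by linarith)
          (by rw [ek]; exact (mul_le_mul_of_nonneg_left b1 hθ0.le).trans hkθ)
          (by rw [ek]; exact (mul_le_mul_of_nonneg_left b2 hθ0.le).trans hkθ)
        rw [ek] at h2
        have h3 := H.young_le_field_mul hp (k / 2)
        have h4 : (1 - (1 - θ) ^ p) * young h (k / 2) ≤
            young h a + young h b - 2 * young h m := by
          have := mul_le_mul_of_nonneg_left h2 (show 0 ≤ k / 2 by linarith)
          have := mul_le_mul_of_nonneg_left h3 hc.le
          linarith
        have h5 := H.young_mul_le hp (c := 4) (by norm_num) (k / 2)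
        have e4 : 4 * (k / 2) = a - b := by rw [hk]; ring
        rw [e4] at h5
        have h6 : young h (k / 2) ≤
            (young h a + young h b - 2 * young h m) / (1 - (1 - θ) ^ p) := by
          rw [le_div_iff₀ hc]
          linarith
        have h7 := mul_le_mul_of_nonneg_left h6 (Real.rpow_nonneg (show (0 : ℝ) ≤ 4 by norm_num)
          (q + 1))
        have h8 : 4 ^ (q + 1) * ((young h a + young h b - 2 * young h m) / (1 - (1 - θ) ^ p)) =
          4 ^ (q + 1) / (1 - (1 - θ) ^ p) * (young h a + young h b - 2 * young h m) := by ring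
        have h9 : 0 ≤ ε * (young h a + young h b) := by positivity
        linarith
  intro a b
  rcases le_total b a with hab | hab
  · exact main a b hab
  · have := main b a hab
    rw [← young_neg, neg_sub, add_comm (young h b), add_comm b] at this
    exact this

end FracOrlicz

end

/-! ### Musielak–Orlicz modulars on a measure space. -/

noncomputable section

namespace FracOrlicz

variable {X : Type*} [MeasurableSpace X]

/-- The Musielak–Orlicz modular `∫ young (k x) (f x) dν(x)`. -/
def modular (ν : Measure X) (k : X → ℝ → ℝ) (f : X → ℝ) : ℝ≥0∞ :=
  ∫⁻ x, ENNReal.ofReal (young (k x) (f x)) ∂ν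

/-- A measurable family of functions with common growth exponents. -/
structure GrowthField (ν : Measure X) (p q : ℝ) (k : X → ℝ → ℝ) : Prop where
  exponent_pos : 0 < p
  measurable : Measurable fun z : X × ℝ => k z.1 z.2
  growth : ∀ᵐ x ∂ν, Growth p q (k x)

lemma tendsto_zero_of_young_tendsto_zero {p q : ℝ} {h : ℝ → ℝ} (H : Growth p q h) (hp : 0 < p)
    {ι : Type*} {l : Filter ι} {a : ι → ℝ} (ha : Tendsto (fun n => young h (a n)) l (𝓝 0)) :
    Tendsto a l (𝓝 0) := by
  rw [Metric.tendsto_nhds]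
  intro ε hε
  filter_upwards [ha.eventually (gt_mem_nhds (H.young_pos hp hε.ne'))] with n hn
  rw [Real.dist_0_eq_abs]
  by_contra hcon
  push Not at hcon
  exact absurd (H.young_mono hp (a := ε) (b := a n) (by rwa [abs_of_pos hε])) (not_le.2 hn)

namespace GrowthField

variable {ν : Measure X} {p q : ℝ} {k : X → ℝ → ℝ}

/-- The variable upper limit is moved into an indicator on `X × ℝ`, which makes the Young function a
parameter integral of a jointly measurable integrand. -/
lemma aemeasurable_young (H : GrowthField ν p q k) {f : X → ℝ} (hf : AEMeasurable f ν) :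
    AEMeasurable (fun x => young (k x) (f x)) ν := by
  obtain ⟨f', hf', hff'⟩ := hf
  have hm : Measurable fun z : X × ℝ => {z : X × ℝ | 0 < z.2 ∧ z.2 ≤ |f' z.1|}.indicator
      (fun z => k z.1 z.2 * z.2) z := by
    refine (H.measurable.mul measurable_snd).indicator ?_
    exact (measurableSet_lt measurable_const measurable_snd).inter
      (measurableSet_le measurable_snd (hf'.comp measurable_fst).abs)
  refine ⟨fun x => ∫ ρ, {z : X × ℝ | 0 < z.2 ∧ z.2 ≤ |f' z.1|}.indicator
      (fun z => k z.1 z.2 * z.2) (x, ρ),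
    hm.stronglyMeasurable.integral_prod_right.measurable, ?_⟩
  filter_upwards [hff'] with x hx
  rw [hx, young, intervalIntegral.integral_of_le (abs_nonneg _),
    ← integral_indicator measurableSet_Ioc]
  rfl

lemma aemeasurable_field (H : GrowthField ν p q k) {f : X → ℝ} (hf : AEMeasurable f ν) :
    AEMeasurable (fun x => field (k x) (f x)) ν :=
  (H.measurable.comp_aemeasurable
    (aemeasurable_id.prodMk (continuous_abs.measurable.comp_aemeasurable hf))).mul hf

lemma modular_mono (H : GrowthField ν p q k) {f g : X → ℝ} (hfg : ∀ᵐ x ∂ν, |f x| ≤ |g x|) :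
    modular ν k f ≤ modular ν k g := by
  refine lintegral_mono_ae ?_
  filter_upwards [hfg, H.growth] with x hx hG
  exact ENNReal.ofReal_le_ofReal (hG.young_mono H.exponent_pos hx)

lemma _root_.FracOrlicz.modular_congr {f g : X → ℝ} (hfg : f =ᵐ[ν] g) :
    modular ν k f = modular ν k g := by
  refine lintegral_congr_ae ?_
  filter_upwards [hfg] with x hx
  rw [hx]

lemma modular_zero : modular ν k (fun _ => 0) = 0 := by
  simp [modular, young_zero]

lemma modular_mul_le (H : GrowthField ν p q k) {c : ℝ} (hc : 1 ≤ c) (f : X → ℝ) :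
    modular ν k (fun x => c * f x) ≤ ENNReal.ofReal (c ^ (q + 1)) * modular ν k f := by
  rw [modular, modular, ← lintegral_const_mul' _ _ ENNReal.ofReal_ne_top]
  refine lintegral_mono_ae ?_
  filter_upwards [H.growth] with x hG
  rw [← ENNReal.ofReal_mul (Real.rpow_nonneg (by linarith) _)]
  exact ENNReal.ofReal_le_ofReal (hG.young_mul_le H.exponent_pos hc _)

lemma modular_mul_le_of_le_one (H : GrowthField ν p q k) {t : ℝ} (ht0 : 0 ≤ t) (ht1 : t ≤ 1)
    (f : X → ℝ) : modular ν k (fun x => t * f x) ≤ ENNReal.ofReal t * modular ν k f := by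
  rw [modular, modular, ← lintegral_const_mul' _ _ ENNReal.ofReal_ne_top]
  refine lintegral_mono_ae ?_
  filter_upwards [H.growth] with x hG
  rw [← ENNReal.ofReal_mul ht0]
  exact ENNReal.ofReal_le_ofReal (hG.young_mul_le_of_le_one H.exponent_pos ht0 ht1 _)

lemma modular_mul_le_max (H : GrowthField ν p q k) (c : ℝ) (f : X → ℝ) :
    modular ν k (fun x => c * f x) ≤ ENNReal.ofReal (max 1 |c| ^ (q + 1)) * modular ν k f := by
  refine le_trans (H.modular_mono (g := fun x => max 1 |c| * f x) (ae_of_all _ fun x => ?_))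
    (H.modular_mul_le (le_max_left _ _) f)
  rw [abs_mul, abs_mul]
  exact mul_le_mul_of_nonneg_right ((le_max_right _ _).trans (le_abs_self _)) (abs_nonneg _)

lemma modular_add_le (H : GrowthField ν p q k) {f : X → ℝ} (hf : AEMeasurable f ν) (g : X → ℝ) :
    modular ν k (fun x => f x + g x) ≤
      ENNReal.ofReal (2 ^ (q + 1)) * (modular ν k f + modular ν k g) := by
  rw [modular, modular, modular, ← lintegral_add_left' (H.aemeasurable_young hf).ennreal_ofReal,
    ← lintegral_const_mul' _ _ ENNReal.ofReal_ne_top]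
  refine lintegral_mono_ae ?_
  filter_upwards [H.growth] with x hG
  rw [← ENNReal.ofReal_add (hG.young_nonneg H.exponent_pos _) (hG.young_nonneg H.exponent_pos _),
    ← ENNReal.ofReal_mul (Real.rpow_nonneg (by norm_num) _)]
  exact ENNReal.ofReal_le_ofReal (hG.young_add_le H.exponent_pos _ _)

lemma modular_mul_lt_top (H : GrowthField ν p q k) (c : ℝ) {f : X → ℝ}
    (hf : modular ν k f < ⊤) : modular ν k (fun x => c * f x) < ⊤ :=
  (H.modular_mul_le_max c f).trans_lt (ENNReal.mul_lt_top ENNReal.ofReal_lt_top hf)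

lemma modular_add_lt_top (H : GrowthField ν p q k) {f g : X → ℝ} (hf : AEMeasurable f ν)
    (hf' : modular ν k f < ⊤) (hg : modular ν k g < ⊤) : modular ν k (fun x => f x + g x) < ⊤ :=
  (H.modular_add_le hf g).trans_lt
    (ENNReal.mul_lt_top ENNReal.ofReal_lt_top (ENNReal.add_lt_top.2 ⟨hf', hg⟩))

lemma modular_sum_lt_top (H : GrowthField ν p q k) {ι : Type*} (s : Finset ι) {f : ι → X → ℝ}
    (hf : ∀ i, AEMeasurable (f i) ν) (hf' : ∀ i, modular ν k (f i) < ⊤) :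
    modular ν k (fun x => ∑ i ∈ s, f i x) < ⊤ := by
  classical
  induction s using Finset.induction_on with
  | empty => simp [modular_zero]
  | insert i s hi ih =>
    simp only [Finset.sum_insert hi]
    exact H.modular_add_lt_top (hf i) (hf' i) ih

lemma tendsto_modular_mul (H : GrowthField ν p q k) (c : ℝ) {f : ℕ → X → ℝ}
    (hf : Tendsto (fun n => modular ν k (f n)) atTop (𝓝 0)) :
    Tendsto (fun n => modular ν k (fun x => c * f n x)) atTop (𝓝 0) := by
  have := ENNReal.Tendsto.const_mul (a := ENNReal.ofReal (max 1 |c| ^ (q + 1))) hf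
    (Or.inr ENNReal.ofReal_ne_top)
  rw [mul_zero] at this
  exact tendsto_of_tendsto_of_tendsto_of_le_of_le tendsto_const_nhds this (fun _ => zero_le)
    fun n => H.modular_mul_le_max c (f n)

lemma tendsto_modular_add (H : GrowthField ν p q k) {f g : ℕ → X → ℝ}
    (hfm : ∀ n, AEMeasurable (f n) ν)
    (hf : Tendsto (fun n => modular ν k (f n)) atTop (𝓝 0))
    (hg : Tendsto (fun n => modular ν k (g n)) atTop (𝓝 0)) :
    Tendsto (fun n => modular ν k (fun x => f n x + g n x)) atTop (𝓝 0) := by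
  have := ENNReal.Tendsto.const_mul (a := ENNReal.ofReal (2 ^ (q + 1))) (hf.add hg)
    (Or.inr ENNReal.ofReal_ne_top)
  rw [add_zero, mul_zero] at this
  exact tendsto_of_tendsto_of_tendsto_of_le_of_le tendsto_const_nhds this (fun _ => zero_le)
    fun n => H.modular_add_le (hfm n) (g n)

/-- Modular convergence is `L¹` convergence of `young (k x) (f n x)`, so a subsequence of these
converges a.e.; a Young function is bounded below away from the origin, so the arguments converge
too. -/
lemma exists_subseq_ae_tendsto (H : GrowthField ν p q k) {f : ℕ → X → ℝ}
    (hfm : ∀ n, AEMeasurable (f n) ν)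
    (hf : Tendsto (fun n => modular ν k (f n)) atTop (𝓝 0)) :
    ∃ ns : ℕ → ℕ, StrictMono ns ∧ ∀ᵐ x ∂ν, Tendsto (fun n => f (ns n) x) atTop (𝓝 0) := by
  have hm : TendstoInMeasure ν (fun n x => young (k x) (f n x)) atTop (fun _ => 0) := by
    refine tendstoInMeasure_of_tendsto_eLpNorm one_ne_zero
      (fun n => (H.aemeasurable_young (hfm n)).aestronglyMeasurable)
      aestronglyMeasurable_const ?_
    refine hf.congr fun n => ?_
    rw [eLpNorm_one_eq_lintegral_enorm]
    refine lintegral_congr_ae ?_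
    filter_upwards [H.growth] with x hG
    simp only [Pi.sub_apply, sub_zero]
    rw [Real.enorm_eq_ofReal (hG.young_nonneg H.exponent_pos _)]
  obtain ⟨ns, hns, hlim⟩ := hm.exists_seq_tendsto_ae
  refine ⟨ns, hns, ?_⟩
  filter_upwards [hlim, H.growth] with x hx hG
  exact tendsto_zero_of_young_tendsto_zero hG H.exponent_pos hx

/-- Generalized dominated convergence for modulars. -/
lemma tendsto_modular_of_dominated (H : GrowthField ν p q k) {f a : ℕ → X → ℝ} {b : X → ℝ}
    (hfm : ∀ n, AEMeasurable (f n) ν) (ham : ∀ n, AEMeasurable (a n) ν)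
    (hb : modular ν k b < ⊤) (ha : Tendsto (fun n => modular ν k (a n)) atTop (𝓝 0))
    (hle : ∀ n, ∀ᵐ x ∂ν, |f n x| ≤ |a n x| + |b x|)
    (hlim : ∀ᵐ x ∂ν, Tendsto (fun n => f n x) atTop (𝓝 0)) :
    Tendsto (fun n => modular ν k (f n)) atTop (𝓝 0) := by
  set C := ENNReal.ofReal (2 ^ (q + 1)) with hC
  have hpt : ∀ n, ∀ᵐ x ∂ν, ENNReal.ofReal (young (k x) (f n x)) ≤
      C * ENNReal.ofReal (young (k x) (a n x)) + C * ENNReal.ofReal (young (k x) (b x)) := by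
    intro n
    filter_upwards [hle n, H.growth] with x hx hG
    rw [← mul_add, hC, ← ENNReal.ofReal_add (hG.young_nonneg H.exponent_pos _)
      (hG.young_nonneg H.exponent_pos _), ← ENNReal.ofReal_mul (Real.rpow_nonneg (by norm_num) _)]
    refine ENNReal.ofReal_le_ofReal ?_
    refine (hG.young_mono H.exponent_pos (b := |a n x| + |b x|) ?_).trans ?_
    · exact hx.trans (le_abs_self _)
    · have := hG.young_add_le H.exponent_pos |a n x| |b x|
      rwa [young_abs, young_abs] at this
  have hCtop : C ≠ ⊤ := ENNReal.ofReal_ne_top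
  -- Subtracting the part due to `a n`, whose integral vanishes in the limit, leaves truncated
  -- differences with a fixed integrable majorant.
  have h1 : Tendsto (fun n => ∫⁻ x, (ENNReal.ofReal (young (k x) (f n x)) -
      C * ENNReal.ofReal (young (k x) (a n x))) ∂ν) atTop (𝓝 (∫⁻ _, 0 ∂ν)) := by
    refine tendsto_lintegral_of_dominated_convergence'
      (fun x => C * ENNReal.ofReal (young (k x) (b x)))
      (fun n => (H.aemeasurable_young (hfm n)).ennreal_ofReal.sub
        ((H.aemeasurable_young (ham n)).ennreal_ofReal.const_mul C)) ?_ ?_ ?_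
    · intro n
      filter_upwards [hpt n] with x hx
      exact tsub_le_iff_left.2 hx
    · rw [lintegral_const_mul' _ _ hCtop]
      exact (ENNReal.mul_lt_top hCtop.lt_top hb).ne
    · filter_upwards [hlim, H.growth] with x hx hG
      have h2 : Tendsto (fun n => ENNReal.ofReal (young (k x) (f n x))) atTop (𝓝 0) := by
        have := ENNReal.tendsto_ofReal
          (((hG.continuous_young H.exponent_pos).tendsto 0).comp hx)
        simpa [young_zero] using this
      exact tendsto_of_tendsto_of_tendsto_of_le_of_le tendsto_const_nhds h2 (fun _ => zero_le)
        fun n => tsub_le_self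
  have h2 := h1.add (ENNReal.Tendsto.const_mul (a := C) ha (Or.inr hCtop))
  rw [lintegral_zero, mul_zero, add_zero] at h2
  refine tendsto_of_tendsto_of_tendsto_of_le_of_le tendsto_const_nhds h2 (fun _ => zero_le)
    fun n => ?_
  simp only [modular]
  rw [← lintegral_const_mul' _ _ hCtop,
    ← lintegral_add_right' _ ((H.aemeasurable_young (ham n)).ennreal_ofReal.const_mul C)]
  exact lintegral_mono fun x => le_tsub_add

/-- Fatou's lemma for modulars. -/
lemma modular_le_of_tendsto (H : GrowthField ν p q k) {f : ℕ → X → ℝ} {g : X → ℝ} {M : ℝ≥0∞}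
    (hfm : ∀ n, AEMeasurable (f n) ν) (hM : ∀ᶠ n in atTop, modular ν k (f n) ≤ M)
    (hlim : ∀ᵐ x ∂ν, Tendsto (fun n => f n x) atTop (𝓝 (g x))) : modular ν k g ≤ M := by
  have h1 : modular ν k g =
      ∫⁻ x, liminf (fun n => ENNReal.ofReal (young (k x) (f n x))) atTop ∂ν := by
    refine lintegral_congr_ae ?_
    filter_upwards [hlim, H.growth] with x hx hG
    exact (ENNReal.tendsto_ofReal
      (((hG.continuous_young H.exponent_pos).tendsto (g x)).comp hx)).liminf_eq.symm
  rw [h1]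
  refine (lintegral_liminf_le' fun n => (H.aemeasurable_young (hfm n)).ennreal_ofReal).trans ?_
  exact liminf_le_of_frequently_le' hM.frequently

/-- Sequences whose rescaled modulars decay geometrically are summable almost everywhere. -/
lemma ae_summable (H : GrowthField ν p q k) {f : ℕ → X → ℝ} (hfm : ∀ n, AEMeasurable (f n) ν)
    (hf : ∀ n, modular ν k (fun x => 2 ^ n * f n x) ≤ 2⁻¹ ^ n) :
    ∀ᵐ x ∂ν, Summable fun n => f n x := by
  have hsum : ∑' n, modular ν k (fun x => 2 ^ n * f n x) ≠ ⊤ := by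
    refine ((ENNReal.tsum_le_tsum hf).trans_lt ?_).ne
    rw [ENNReal.tsum_geometric, ENNReal.one_sub_inv_two, inv_inv]
    exact ENNReal.ofNat_lt_top
  have hmeas : ∀ n, AEMeasurable (fun x => ENNReal.ofReal (young (k x) (2 ^ n * f n x))) ν :=
    fun n => (H.aemeasurable_young ((hfm n).const_mul _)).ennreal_ofReal
  have h1 : ∫⁻ x, ∑' n, ENNReal.ofReal (young (k x) (2 ^ n * f n x)) ∂ν ≠ ⊤ := by
    rw [lintegral_tsum hmeas]
    exact hsum
  filter_upwards [ae_lt_top' (AEMeasurable.tsum hmeas) h1, H.growth] with x hx hG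
  have h2 := ENNReal.tendsto_atTop_zero_of_tsum_ne_top hx.ne
  have h3 : Tendsto (fun n => young (k x) (2 ^ n * f n x)) atTop (𝓝 0) := by
    have := (ENNReal.tendsto_toReal ENNReal.zero_ne_top).comp h2
    refine this.congr fun n => ?_
    exact ENNReal.toReal_ofReal (hG.young_nonneg H.exponent_pos _)
  -- Here `2 ^ n * f n x → 0`, so eventually `|f n x| ≤ 2 ^ (-n)`, a summable bound.
  have h4 := tendsto_zero_of_young_tendsto_zero hG H.exponent_pos h3
  have h5 : ∀ᶠ n in atTop, ‖f n x‖ ≤ (1 / 2 : ℝ) ^ n := by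
    have := (Metric.tendsto_nhds.1 h4) 1 one_pos
    filter_upwards [this] with n hn
    rw [Real.dist_0_eq_abs, abs_mul, abs_of_pos (by positivity)] at hn
    rw [Real.norm_eq_abs, div_pow, one_pow, le_div_iff₀ (by positivity), mul_comm]
    exact hn.le
  exact Summable.of_norm_bounded_eventually_nat summable_geometric_two h5

lemma integrable_young (H : GrowthField ν p q k) {f : X → ℝ} (hf : AEMeasurable f ν)
    (hf' : modular ν k f < ⊤) : Integrable (fun x => young (k x) (f x)) ν := by
  refine ⟨(H.aemeasurable_young hf).aestronglyMeasurable, ?_⟩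
  rw [hasFiniteIntegral_iff_ofReal]
  · exact hf'
  · filter_upwards [H.growth] with x hG
    exact hG.young_nonneg H.exponent_pos _

lemma modular_eq_ofReal_integral (H : GrowthField ν p q k) {f : X → ℝ} (hf : AEMeasurable f ν)
    (hf' : modular ν k f < ⊤) : modular ν k f = ENNReal.ofReal (∫ x, young (k x) (f x) ∂ν) := by
  rw [ofReal_integral_eq_lintegral_ofReal (H.integrable_young hf hf')]
  · rfl
  · filter_upwards [H.growth] with x hG
    exact hG.young_nonneg H.exponent_pos _

lemma toReal_modular (H : GrowthField ν p q k) {f : X → ℝ} (hf : AEMeasurable f ν)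
    (hf' : modular ν k f < ⊤) : (modular ν k f).toReal = ∫ x, young (k x) (f x) ∂ν := by
  rw [H.modular_eq_ofReal_integral hf hf', ENNReal.toReal_ofReal]
  refine integral_nonneg_of_ae ?_
  filter_upwards [H.growth] with x hG
  exact hG.young_nonneg H.exponent_pos _

lemma modular_abs_add_abs_lt_top (H : GrowthField ν p q k) {f g : X → ℝ} (hf : AEMeasurable f ν)
    (hf' : modular ν k f < ⊤) (hg' : modular ν k g < ⊤) :
    modular ν k (fun x => |f x| + |g x|) < ⊤ := by
  refine H.modular_add_lt_top (continuous_abs.measurable.comp_aemeasurable hf) ?_ ?_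
  · simpa only [modular, young_abs] using hf'
  · simpa only [modular, young_abs] using hg'

/-- Both arguments are at most `|f| + |g|` in modulus, so the Young-type inequality majorizes the
product by `young` of that sum. This is the absolute convergence of `⟨𝓛u, v⟩`. -/
lemma integrable_field_mul (H : GrowthField ν p q k) {f g : X → ℝ} (hf : AEMeasurable f ν)
    (hg : AEMeasurable g ν) (hf' : modular ν k f < ⊤) (hg' : modular ν k g < ⊤) :
    Integrable (fun x => field (k x) (f x) * g x) ν := by
  have h1 : AEMeasurable (fun x => |f x| + |g x|) ν :=
    (continuous_abs.measurable.comp_aemeasurable hf).add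
      (continuous_abs.measurable.comp_aemeasurable hg)
  refine ((H.integrable_young h1
    (H.modular_abs_add_abs_lt_top hf hf' hg')).const_mul (2 ^ (q + 1))).mono'
    ((H.aemeasurable_field hf).mul hg).aestronglyMeasurable ?_
  filter_upwards [H.growth] with x hG
  exact hG.abs_field_mul_le H.exponent_pos (by linarith [abs_nonneg (g x)])
    (by linarith [abs_nonneg (f x)])

/-- Uniform convexity of the modular. -/
lemma exists_modular_uniformConvexity (H : GrowthField ν p q k) {ε : ℝ} (hε : 0 < ε) :
    ∃ C : ℝ, 0 ≤ C ∧ ∀ f g : X → ℝ, AEMeasurable f ν → AEMeasurable g ν →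
      modular ν k f < ⊤ → modular ν k g < ⊤ →
      (modular ν k (fun x => f x - g x)).toReal ≤
        ε * ((modular ν k f).toReal + (modular ν k g).toReal) +
        C * ((modular ν k f).toReal + (modular ν k g).toReal -
          2 * (modular ν k (fun x => (f x + g x) / 2)).toReal) := by
  obtain ⟨C, hC0, hC⟩ := exists_uniformConvexity p q H.exponent_pos hε
  refine ⟨C, hC0, fun f g hf hg hf' hg' => ?_⟩
  have hs : modular ν k (fun x => f x - g x) < ⊤ := by
    have := H.modular_add_lt_top hf hf' (H.modular_mul_lt_top (-1) hg')
    simpa [sub_eq_add_neg] using this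
  have ha : modular ν k (fun x => (f x + g x) / 2) < ⊤ := by
    have := H.modular_mul_lt_top (1 / 2) (H.modular_add_lt_top hf hf' hg')
    simpa [div_eq_inv_mul] using this
  have hd : AEMeasurable (fun x => f x - g x) ν := hf.sub hg
  have hm : AEMeasurable (fun x => (f x + g x) / 2) ν := (hf.add hg).div_const 2
  rw [H.toReal_modular hf hf', H.toReal_modular hg hg', H.toReal_modular hd hs,
    H.toReal_modular hm ha]
  have i1 := H.integrable_young hf hf'
  have i2 := H.integrable_young hg hg'
  have i3 := H.integrable_young hd hs
  have i4 := H.integrable_young hm ha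
  have i5 : Integrable (fun x => young (k x) (f x) + young (k x) (g x)) ν := i1.add i2
  have i6 : Integrable (fun x => young (k x) (f x) + young (k x) (g x) -
      2 * young (k x) ((f x + g x) / 2)) ν := i5.sub (i4.const_mul 2)
  rw [← integral_add i1 i2, ← integral_const_mul, ← integral_const_mul,
    ← integral_sub i5 (i4.const_mul 2), ← integral_const_mul,
    ← integral_add (i5.const_mul ε) (i6.const_mul C)]
  refine integral_mono_ae i3 ((i5.const_mul ε).add (i6.const_mul C)) ?_
  filter_upwards [H.growth] with x hG
  exact hC (k x) hG (f x) (g x)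

/-- First variation at a minimizer: if `f` minimizes the modular along the segment towards `f + g`,
then the derivative in the direction `g` is non-negative. -/
lemma integral_field_mul_nonneg (H : GrowthField ν p q k) {f g : X → ℝ} (hf : AEMeasurable f ν)
    (hg : AEMeasurable g ν) (hf' : modular ν k f < ⊤) (hg' : modular ν k g < ⊤)
    (hmin : ∀ t : ℝ, 0 < t → t ≤ 1 → modular ν k f ≤ modular ν k (fun x => f x + t * g x)) :
    0 ≤ ∫ x, field (k x) (f x) * g x ∂ν := by
  set t : ℕ → ℝ := fun n => 1 / ((n : ℝ) + 1) with ht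
  have ht0 : ∀ n, 0 < t n := fun n => by positivity
  have ht1 : ∀ n, t n ≤ 1 := fun n => by
    rw [ht]
    exact (div_le_one (by positivity)).2 (by linarith [(Nat.cast_nonneg n : (0 : ℝ) ≤ n)])
  have hm : ∀ n, AEMeasurable (fun x => f x + t n * g x) ν := fun n => hf.add (hg.const_mul _)
  have hfin : ∀ n, modular ν k (fun x => f x + t n * g x) < ⊤ := fun n =>
    H.modular_add_lt_top hf hf' (H.modular_mul_lt_top _ hg')
  -- The gradient inequality is used at the perturbed point `f + t g`, so minimality gives a sign
  -- for every `t > 0` without differentiating under the integral; then `t → 0` by dominated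
  -- convergence.
  have hn : ∀ n, 0 ≤ ∫ x, field (k x) (f x + t n * g x) * g x ∂ν := by
    intro n
    have h1 := ENNReal.toReal_mono (hfin n).ne (hmin (t n) (ht0 n) (ht1 n))
    rw [H.toReal_modular hf hf', H.toReal_modular (hm n) (hfin n)] at h1
    have h2 : ∫ x, young (k x) (f x + t n * g x) ∂ν - ∫ x, young (k x) (f x) ∂ν ≤
        t n * ∫ x, field (k x) (f x + t n * g x) * g x ∂ν := by
      rw [← integral_sub (H.integrable_young (hm n) (hfin n)) (H.integrable_young hf hf'),
        ← integral_const_mul]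
      refine integral_mono_ae
        ((H.integrable_young (hm n) (hfin n)).sub (H.integrable_young hf hf'))
        ((H.integrable_field_mul (hm n) hg (hfin n) hg').const_mul _) ?_
      filter_upwards [H.growth] with x hG
      have := hG.field_mul_sub_le H.exponent_pos (f x + t n * g x) (f x)
      linarith
    have h3 : 0 ≤ t n * ∫ x, field (k x) (f x + t n * g x) * g x ∂ν := by linarith
    exact nonneg_of_mul_nonneg_right h3 (ht0 n)
  have hs : AEMeasurable (fun x => |f x| + |g x|) ν :=
    (continuous_abs.measurable.comp_aemeasurable hf).add
      (continuous_abs.measurable.comp_aemeasurable hg)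
  have hlim : Tendsto (fun n => ∫ x, field (k x) (f x + t n * g x) * g x ∂ν) atTop
      (𝓝 (∫ x, field (k x) (f x) * g x ∂ν)) := by
    refine tendsto_integral_of_dominated_convergence
      (fun x => 2 ^ (q + 1) * young (k x) (|f x| + |g x|))
      (fun n => ((H.aemeasurable_field (hm n)).mul hg).aestronglyMeasurable)
      ((H.integrable_young hs (H.modular_abs_add_abs_lt_top hf hf' hg')).const_mul _) ?_ ?_
    · intro n
      filter_upwards [H.growth] with x hG
      refine hG.abs_field_mul_le H.exponent_pos ?_ (by linarith [abs_nonneg (f x)])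
      refine (abs_add_le _ _).trans ?_
      rw [abs_mul, abs_of_pos (ht0 n)]
      have := mul_le_mul_of_nonneg_right (ht1 n) (abs_nonneg (g x))
      linarith
    · filter_upwards [H.growth] with x hG
      have h1 : Tendsto (fun n => f x + t n * g x) atTop (𝓝 (f x)) := by
        have := (tendsto_one_div_add_atTop_nhds_zero_nat (𝕜 := ℝ)).mul_const (g x)
        rw [zero_mul] at this
        simpa only [add_zero] using this.const_add (f x)
      exact (((hG.continuous_field H.exponent_pos).tendsto _).comp h1).mul_const _
  exact ge_of_tendsto' hlim hn

/-- Lower semicontinuity of the modular along modular convergence, in quantitative form. -/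
lemma le_modular_of_tendsto (H : GrowthField ν p q k) {f : ℕ → X → ℝ} {g : X → ℝ} {m : ℝ≥0∞}
    (hgm : AEMeasurable g ν)
    (hm : ∀ n, m ≤ modular ν k (f n))
    (hfg : Tendsto (fun n => modular ν k (fun x => f n x - g x)) atTop (𝓝 0)) :
    m ≤ modular ν k g := by
  -- Write `f n` as the convex combination of `g / (1 - t)` and `(f n - g) / t`. Doubling bounds
  -- both terms; the second vanishes as `n → ∞`, and then `t → 0` restores the constant `1`.
  have key : ∀ t : ℝ, 0 < t → t < 1 →
      m ≤ ENNReal.ofReal ((1 - t)⁻¹ ^ (q + 1)) * modular ν k g := by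
    intro t ht0 ht1
    have hpt : ∀ n, m ≤ ENNReal.ofReal ((1 - t)⁻¹ ^ (q + 1)) * modular ν k g +
        ENNReal.ofReal (t⁻¹ ^ (q + 1)) * modular ν k (fun x => f n x - g x) := by
      intro n
      refine (hm n).trans ?_
      simp only [modular]
      rw [← lintegral_const_mul' _ _ ENNReal.ofReal_ne_top,
        ← lintegral_const_mul' _ _ ENNReal.ofReal_ne_top, ← lintegral_add_left'
          ((H.aemeasurable_young hgm).ennreal_ofReal.const_mul _)]
      refine lintegral_mono_ae ?_
      filter_upwards [H.growth] with x hG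
      have hp := H.exponent_pos
      have h1t : 0 < 1 - t := by linarith
      have h1 := hG.young_convex hp ht0.le ht1.le ((1 - t)⁻¹ * g x) (t⁻¹ * (f n x - g x))
      have e : (1 - t) * ((1 - t)⁻¹ * g x) + t * (t⁻¹ * (f n x - g x)) = f n x := by
        field_simp
        ring
      rw [e] at h1
      have h2 := hG.young_mul_le hp ((one_le_inv₀ h1t).2 (by linarith)) (g x)
      have h3 := hG.young_mul_le hp ((one_le_inv₀ ht0).2 ht1.le) (f n x - g x)
      have y1 := hG.young_nonneg hp ((1 - t)⁻¹ * g x)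
      have y2 := hG.young_nonneg hp (t⁻¹ * (f n x - g x))
      rw [← ENNReal.ofReal_mul (by positivity), ← ENNReal.ofReal_mul (by positivity),
        ← ENNReal.ofReal_add (mul_nonneg (by positivity) (hG.young_nonneg hp _))
          (mul_nonneg (by positivity) (hG.young_nonneg hp _))]
      refine ENNReal.ofReal_le_ofReal ?_
      nlinarith
    have hl := (ENNReal.Tendsto.const_mul (a := ENNReal.ofReal (t⁻¹ ^ (q + 1))) hfg
      (Or.inr ENNReal.ofReal_ne_top)).const_add
        (ENNReal.ofReal ((1 - t)⁻¹ ^ (q + 1)) * modular ν k g)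
    rw [mul_zero, add_zero] at hl
    exact ge_of_tendsto' hl hpt
  rcases eq_or_ne (modular ν k g) ⊤ with htop | htop
  · rw [htop]
    exact le_top
  have hl : Tendsto (fun t : ℝ => ENNReal.ofReal ((1 - t)⁻¹ ^ (q + 1)) * modular ν k g)
      (𝓝[>] 0) (𝓝 (modular ν k g)) := by
    have h1 : ContinuousAt (fun t : ℝ => (1 - t)⁻¹ ^ (q + 1)) 0 := by
      refine ContinuousAt.rpow_const (ContinuousAt.inv₀ (by fun_prop) (by norm_num)) ?_
      left
      norm_num
    have h2 := ENNReal.Tendsto.mul_const (b := modular ν k g)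
      (ENNReal.tendsto_ofReal (h1.tendsto.mono_left (nhdsWithin_le_nhds (s := Ioi 0))))
      (Or.inr htop)
    simpa using h2
  refine ge_of_tendsto hl ?_
  filter_upwards [Ioo_mem_nhdsGT (zero_lt_one (α := ℝ))] with t ht
  exact key t ht.1 ht.2

end GrowthField

end FracOrlicz

end

/-! ### Mollification, cut-off functions and stability of the test classes. -/

noncomputable section

namespace FracOrlicz

section Mollification

variable {d : ℕ}

lemma norm_integral_normed_mul_le (ψ : ContDiffBump (0 : Space d)) {F : Space d → ℝ} {C : ℝ}
    (hF : ∀ t ∈ Metric.ball (0 : Space d) ψ.rOut, |F t| ≤ C) :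
    |∫ t, ψ.normed volume t * F t| ≤ C := by
  have h1 : ∀ t, ‖ψ.normed volume t * F t‖ ≤ C * ψ.normed volume t := by
    intro t
    rw [Real.norm_eq_abs, abs_mul, abs_of_nonneg (ψ.nonneg_normed t), mul_comm]
    by_cases ht : t ∈ Metric.ball (0 : Space d) ψ.rOut
    · exact mul_le_mul_of_nonneg_right (hF t ht) (ψ.nonneg_normed t)
    · have : ψ.normed volume t = 0 := by
        rw [← ψ.support_normed_eq (μ := volume)] at ht
        exact Function.notMem_support.1 ht
      simp [this]
  have := norm_integral_le_of_norm_le (ψ.integrable_normed.const_mul C) (ae_of_all _ h1)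
  rwa [integral_const_mul, ψ.integral_normed, mul_one, Real.norm_eq_abs] at this

/-- Mollification of `w` by the normalized bump function `ψ`. -/
def mollify (ψ : ContDiffBump (0 : Space d)) (w : Space d → ℝ) (x : Space d) : ℝ :=
  ∫ t, ψ.normed volume t * w (x - t)

lemma integrable_normed_mul (ψ : ContDiffBump (0 : Space d)) {F : Space d → ℝ}
    (hF : Continuous F) : Integrable fun t => ψ.normed volume t * F t :=
  (ψ.continuous_normed.mul hF).integrable_of_hasCompactSupport
    (ψ.hasCompactSupport_normed.mul_right)

lemma contDiff_mollify (ψ : ContDiffBump (0 : Space d)) {w : Space d → ℝ} (hw : Continuous w) :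
    ContDiff ℝ ∞ (mollify ψ w) :=
  ψ.hasCompactSupport_normed.contDiff_convolution_left (ContinuousLinearMap.lsmul ℝ ℝ)
    ψ.contDiff_normed hw.locallyIntegrable

lemma abs_mollify_sub_mollify_le (ψ : ContDiffBump (0 : Space d)) {w : Space d → ℝ} {L : NNReal}
    (hw : LipschitzWith L w) (x y : Space d) :
    |mollify ψ w x - mollify ψ w y| ≤ L * ‖x - y‖ := by
  have hc := hw.continuous
  rw [mollify, mollify, ← integral_sub (integrable_normed_mul ψ (by fun_prop))
    (integrable_normed_mul ψ (by fun_prop))]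
  simp only [← mul_sub]
  refine norm_integral_normed_mul_le ψ fun t _ => ?_
  have := hw.dist_le_mul (x - t) (y - t)
  rwa [Real.dist_eq, dist_eq_norm, sub_sub_sub_cancel_right] at this

lemma abs_mollify_sub_le (ψ : ContDiffBump (0 : Space d)) {w : Space d → ℝ} {L : NNReal}
    (hw : LipschitzWith L w) (x : Space d) :
    |mollify ψ w x - w x| ≤ L * ψ.rOut := by
  have hc := hw.continuous
  have e : w x = ∫ t, ψ.normed volume t * w x := by
    rw [integral_mul_const, ψ.integral_normed, one_mul]
  rw [mollify, e, ← integral_sub (integrable_normed_mul ψ (by fun_prop))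
    (integrable_normed_mul ψ (by fun_prop))]
  simp only [← mul_sub]
  refine norm_integral_normed_mul_le ψ fun t ht => ?_
  have := hw.dist_le_mul (x - t) x
  rw [Real.dist_eq, dist_eq_norm, sub_sub_cancel_left, norm_neg] at this
  refine this.trans (mul_le_mul_of_nonneg_left ?_ L.2)
  exact (mem_ball_zero_iff.1 ht).le

lemma abs_mollify_le (ψ : ContDiffBump (0 : Space d)) {w : Space d → ℝ} {M : ℝ} (x : Space d)
    (hw : ∀ y ∈ Metric.ball x ψ.rOut, |w y| ≤ M) : |mollify ψ w x| ≤ M := by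
  refine norm_integral_normed_mul_le ψ fun t ht => hw _ ?_
  rw [Metric.mem_ball, dist_eq_norm, sub_sub_cancel_left, norm_neg]
  exact mem_ball_zero_iff.1 ht

/-- Lipschitz functions with compact support in an open set are pointwise limits of test functions
with uniform Lipschitz constants, uniform bounds and supports in a common compact set. -/
lemma IsLipTest.exists_mollified {Ω : Set (Space d)} (hΩ : IsOpen Ω) {w : Space d → ℝ} {L : NNReal}
    (hL : LipschitzWith L w) {M : ℝ} (hM : ∀ x, |w x| ≤ M) (hw : HasCompactSupport w)
    (hwΩ : tsupport w ⊆ Ω) :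
    ∃ K ⊆ Ω, IsCompact K ∧ tsupport w ⊆ K ∧ ∃ φ : ℕ → Space d → ℝ, (∀ n, IsTest Ω (φ n)) ∧
      (∀ n x y, |φ n x - φ n y| ≤ L * ‖x - y‖) ∧ (∀ n x, |φ n x| ≤ M) ∧
      (∀ n, ∀ x ∉ K, φ n x = 0) ∧ ∀ x, Tendsto (fun n => φ n x) atTop (𝓝 (w x)) := by
  -- The mollification radii stay at most `δ`, so all supports lie in the compact `δ`-thickening of
  -- `tsupport w`, inside `Ω`.
  obtain ⟨δ, hδ, hδΩ⟩ := IsCompact.exists_cthickening_subset_open hw hΩ hwΩ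
  set r : ℕ → ℝ := fun n => δ / ((n : ℝ) + 1) with hr
  have hr0 : ∀ n, 0 < r n := fun n => by positivity
  have hrδ : ∀ n, r n ≤ δ := fun n => by
    rw [hr]
    exact div_le_self hδ.le (by linarith [(Nat.cast_nonneg n : (0 : ℝ) ≤ n)])
  set ψ : ℕ → ContDiffBump (0 : Space d) := fun n =>
    ⟨r n / 2, r n, half_pos (hr0 n), half_lt_self (hr0 n)⟩ with hψ
  have hzero : ∀ n, ∀ x ∉ Metric.cthickening δ (tsupport w), mollify (ψ n) w x = 0 := by
    intro n x hx
    refine abs_nonpos_iff.1 (abs_mollify_le (ψ n) x fun y hy => ?_)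
    have : y ∉ tsupport w := by
      intro hyw
      refine hx (Metric.mem_cthickening_of_dist_le x y δ _ hyw ?_)
      rw [dist_comm]
      exact (Metric.mem_ball.1 hy).le.trans (hrδ n)
    rw [image_eq_zero_of_notMem_tsupport this, abs_zero]
  have hcomp : IsCompact (Metric.cthickening δ (tsupport w)) := IsCompact.cthickening hw
  have hsub : ∀ n, tsupport (mollify (ψ n) w) ⊆ Metric.cthickening δ (tsupport w) := by
    intro n
    refine closure_minimal (fun x hx => ?_) Metric.isClosed_cthickening
    by_contra hcon
    exact hx (hzero n x hcon)
  refine ⟨_, hδΩ, hcomp, Metric.self_subset_cthickening _, fun n => mollify (ψ n) w,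
    fun n => ⟨contDiff_mollify _ hL.continuous, ?_, (hsub n).trans hδΩ⟩,
    fun n => abs_mollify_sub_mollify_le _ hL, fun n x => abs_mollify_le _ x fun y _ => hM y,
    hzero, fun x => ?_⟩
  · exact hcomp.of_isClosed_subset (isClosed_tsupport _) (hsub n)
  · rw [tendsto_iff_dist_tendsto_zero]
    refine squeeze_zero (fun _ => dist_nonneg) (fun n => abs_mollify_sub_le (ψ n) hL x) ?_
    have : Tendsto (fun n : ℕ => (L : ℝ) * (δ * (1 / ((n : ℝ) + 1)))) atTop
        (𝓝 (L * (δ * 0))) :=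
      (tendsto_one_div_add_atTop_nhds_zero_nat.const_mul _).const_mul _
    rw [mul_zero, mul_zero] at this
    refine this.congr fun n => ?_
    rw [mul_one_div]

lemma exists_isTest_eq_one {Ω K : Set (Space d)} (hΩ : IsOpen Ω) (hK : IsCompact K) (hKΩ : K ⊆ Ω) :
    ∃ η, IsTest Ω η ∧ (∀ x ∈ K, η x = 1) ∧ ∀ x, 0 ≤ η x ∧ η x ≤ 1 := by
  obtain ⟨K', hK', hKK', hK'Ω⟩ := exists_compact_between hK hΩ hKΩ
  obtain ⟨f, hf, hf01, hfs, hf1⟩ := exists_contMDiff_support_eq_eq_one_iff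
    (modelWithCornersSelf ℝ (Space d)) (n := ⊤) isOpen_interior hK.isClosed hKK'
  have hsub : tsupport f ⊆ K' := by
    refine closure_minimal ?_ hK'.isClosed
    rw [hfs]
    exact interior_subset
  exact ⟨f, ⟨hf.contDiff, hK'.of_isClosed_subset (isClosed_tsupport _) hsub, hsub.trans hK'Ω⟩,
    fun x hx => (hf1 x).1 hx, fun x => hf01 (mem_range_self x)⟩

lemma IsTest.isLipTest {Ω : Set (Space d)} {φ : Space d → ℝ} (h : IsTest Ω φ) : IsLipTest Ω φ :=
  ⟨h.1.lipschitzWith_of_hasCompactSupport h.2.1 (by simp), h.2⟩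

lemma IsLipTest.continuous {Ω : Set (Space d)} {φ : Space d → ℝ} (h : IsLipTest Ω φ) :
    Continuous φ := by
  obtain ⟨K, hK⟩ := h.1
  exact hK.continuous

lemma IsLipTest.eq_zero {Ω : Set (Space d)} {φ : Space d → ℝ} (h : IsLipTest Ω φ) {x : Space d}
    (hx : x ∉ Ω) : φ x = 0 :=
  image_eq_zero_of_notMem_tsupport fun hx' => hx (h.2.2 hx')

lemma tsupport_add_subset {f g : Space d → ℝ} :
    tsupport (fun x => f x + g x) ⊆ tsupport f ∪ tsupport g := by
  rw [tsupport, tsupport, tsupport, ← closure_union]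
  refine closure_mono fun x hx => ?_
  by_contra hcon
  simp only [mem_union, Function.mem_support, not_or, not_not] at hcon
  exact hx (by simp [hcon.1, hcon.2])

lemma IsLipTest.add {Ω : Set (Space d)} {φ ψ : Space d → ℝ} (h : IsLipTest Ω φ)
    (h' : IsLipTest Ω ψ) : IsLipTest Ω fun x => φ x + ψ x := by
  obtain ⟨⟨K, hK⟩, hc, hs⟩ := h
  obtain ⟨⟨K', hK'⟩, hc', hs'⟩ := h'
  exact ⟨⟨K + K', hK.add hK'⟩, hc.add hc', tsupport_add_subset.trans (union_subset hs hs')⟩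

lemma IsLipTest.comp {Ω : Set (Space d)} {φ : Space d → ℝ} (h : IsLipTest Ω φ) {T : ℝ → ℝ}
    {K : NNReal} (hT : LipschitzWith K T) (hT0 : T 0 = 0) : IsLipTest Ω fun x => T (φ x) := by
  obtain ⟨⟨K', hK'⟩, hc, hs⟩ := h
  exact ⟨⟨K * K', hT.comp hK'⟩, hc.comp_left hT0, (closure_mono fun x hx => by
    intro hx'
    exact hx (by simp only [hx', hT0])).trans hs⟩

lemma lipschitzWith_const_mul (c : ℝ) : LipschitzWith ‖c‖₊ fun x : ℝ => c * x :=
  LipschitzWith.of_dist_le_mul fun x y => by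
    rw [Real.dist_eq, Real.dist_eq, ← mul_sub, abs_mul, coe_nnnorm, Real.norm_eq_abs]

lemma IsLipTest.const_mul {Ω : Set (Space d)} {φ : Space d → ℝ} (h : IsLipTest Ω φ) (c : ℝ) :
    IsLipTest Ω fun x => c * φ x :=
  h.comp (lipschitzWith_const_mul c) (mul_zero c)

lemma IsTest.add {Ω : Set (Space d)} {φ ψ : Space d → ℝ} (h : IsTest Ω φ)
    (h' : IsTest Ω ψ) : IsTest Ω fun x => φ x + ψ x :=
  ⟨h.1.add h'.1, h.2.1.add h'.2.1, tsupport_add_subset.trans (union_subset h.2.2 h'.2.2)⟩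

lemma IsTest.smooth_mul {Ω : Set (Space d)} {φ : Space d → ℝ} (h : IsTest Ω φ) {f : Space d → ℝ}
    (hf : ContDiff ℝ ∞ f) : IsTest Ω fun x => f x * φ x :=
  ⟨hf.mul h.1, h.2.1.mul_left, (closure_mono fun x hx => by
    intro hx'
    exact hx (by simp only [hx', mul_zero])).trans h.2.2⟩

end Mollification

end FracOrlicz

end

/-! ### The two modulars of the fractional space. -/

noncomputable section

namespace FracOrlicz

variable {d : ℕ}

/-- The field `r ↦ g(x, y, r) / |x - y|ᵈ` on pairs of points. -/
def fracField (g : Space d → Space d → ℝ → ℝ) (z : Space d × Space d) (r : ℝ) : ℝ :=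
  g z.1 z.2 r / ‖z.1 - z.2‖ ^ d

/-- The difference quotient as a function on pairs of points. -/
def pairQuot (s : ℝ) (u : Space d → ℝ) (z : Space d × Space d) : ℝ := diffQuot s u z.1 z.2

/-- Growth of the fields of both modulars. -/
structure IsKernel (gl gu : ℝ) (g : Space d → Space d → ℝ → ℝ) : Prop where
  hat : GrowthField volume gl gu fun x => g x x
  frac : GrowthField volume gl gu (fracField g)

lemma ae_fst_ne_snd (hd : 0 < d) : ∀ᵐ z : Space d × Space d, z.1 ≠ z.2 := by
  have : Nonempty (Fin d) := ⟨⟨0, hd⟩⟩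
  have hm : MeasurableSet {z : Space d × Space d | z.1 = z.2} :=
    measurableSet_eq_fun measurable_fst measurable_snd
  have : volume {z : Space d × Space d | z.1 = z.2} = 0 := by
    rw [Measure.volume_eq_prod, Measure.measure_prod_null hm]
    refine ae_of_all _ fun x => ?_
    have : Prod.mk x ⁻¹' {z : Space d × Space d | z.1 = z.2} = {x} := by
      ext y
      simp [eq_comm]
    change volume (Prod.mk x ⁻¹' {z : Space d × Space d | z.1 = z.2}) = 0
    rw [this, measure_singleton]
  exact measure_eq_zero_iff_ae_notMem.1 this

lemma IsKernel.of_isAdmissible (hd : 0 < d) {gl gu : ℝ} (hgl : 0 < gl)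
    {g : Space d → Space d → ℝ → ℝ}
    (hg_meas : Measurable (fun p : Space d × Space d × ℝ => g p.1 p.2.1 p.2.2))
    (hg : ∀ᵐ z : Space d × Space d, IsAdmissible gl gu (g z.1 z.2))
    (hg_diag : ∀ᵐ x : Space d, IsAdmissible gl gu (g x x)) : IsKernel gl gu g := by
  refine ⟨⟨hgl, ?_, ?_⟩, ⟨hgl, ?_, ?_⟩⟩
  · exact hg_meas.comp (measurable_fst.prodMk (measurable_fst.prodMk measurable_snd))
  · filter_upwards [hg_diag] with x hx
    exact hx.toGrowth
  · have h1 : Measurable fun z : (Space d × Space d) × ℝ => g z.1.1 z.1.2 z.2 :=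
      hg_meas.comp ((measurable_fst.comp measurable_fst).prodMk
        ((measurable_snd.comp measurable_fst).prodMk measurable_snd))
    refine h1.div (Measurable.pow_const (Measurable.norm ?_) d)
    exact (measurable_fst.comp measurable_fst).sub (measurable_snd.comp measurable_fst)
  · filter_upwards [hg, ae_fst_ne_snd hd] with z hz hne
    exact hz.toGrowth.div_const (pow_pos (norm_pos_iff.2 (sub_ne_zero.2 hne)) d)

/-- The weight `|x - y|⁻ᵈ` is absorbed into the field, so the fractional energy is a plain modular
for Lebesgue measure on pairs and the general theory applies. -/
lemma modularFrac_eq (g : Space d → Space d → ℝ → ℝ) (s : ℝ) (u : Space d → ℝ) :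
    modularFrac g s u = modular volume (fracField g) (pairQuot s u) := by
  unfold modularFrac modular
  refine lintegral_congr fun z => ?_
  congr 1
  rw [primitiveG, young, ← intervalIntegral.integral_div]
  refine intervalIntegral.integral_congr fun ρ _ => ?_
  simp only [fracField]
  ring

lemma integrandL_eq (g : Space d → Space d → ℝ → ℝ) (s : ℝ) (u v : Space d → ℝ) :
    integrandL g s u v = fun z => field (fracField g z) (pairQuot s u z) * pairQuot s v z := by
  funext z
  simp only [integrandL, field, fracField, pairQuot]
  ring

section PairQuot

variable (s : ℝ) (u v : Space d → ℝ)

lemma pairQuot_add : pairQuot s (fun x => u x + v x) = fun z => pairQuot s u z + pairQuot s v z := by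
  funext z
  simp only [pairQuot, diffQuot]
  ring

lemma pairQuot_sub : pairQuot s (fun x => u x - v x) = fun z => pairQuot s u z - pairQuot s v z := by
  funext z
  simp only [pairQuot, diffQuot]
  ring

lemma pairQuot_const_mul (c : ℝ) :
    pairQuot s (fun x => c * u x) = fun z => c * pairQuot s u z := by
  funext z
  simp only [pairQuot, diffQuot]
  ring

lemma abs_pairQuot (z : Space d × Space d) :
    |pairQuot s u z| = |u z.1 - u z.2| / ‖z.1 - z.2‖ ^ s := by
  rw [pairQuot, diffQuot, abs_div, abs_of_nonneg (Real.rpow_nonneg (norm_nonneg _) s)]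

variable {s u v}

lemma abs_pairQuot_le_of_le {z : Space d × Space d} {w : Space d → ℝ}
    (h : |u z.1 - u z.2| ≤ |w z.1 - w z.2|) : |pairQuot s u z| ≤ |pairQuot s w z| := by
  rw [abs_pairQuot, abs_pairQuot]
  exact div_le_div_of_nonneg_right h (Real.rpow_nonneg (norm_nonneg _) s)

lemma ae_prod_of_ae {P : Space d → Prop} (h : ∀ᵐ x, P x) :
    ∀ᵐ z : Space d × Space d, P z.1 ∧ P z.2 := by
  rw [Measure.volume_eq_prod]
  exact (Measure.quasiMeasurePreserving_fst.ae h).and (Measure.quasiMeasurePreserving_snd.ae h)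

lemma aemeasurable_pairQuot (hu : AEMeasurable u) : AEMeasurable (pairQuot s u) := by
  have h1 : AEMeasurable (fun z : Space d × Space d => u z.1) := by
    rw [Measure.volume_eq_prod]
    exact hu.comp_quasiMeasurePreserving Measure.quasiMeasurePreserving_fst
  have h2 : AEMeasurable (fun z : Space d × Space d => u z.2) := by
    rw [Measure.volume_eq_prod]
    exact hu.comp_quasiMeasurePreserving Measure.quasiMeasurePreserving_snd
  refine (h1.sub h2).div (Measurable.aemeasurable ?_)
  exact (Measurable.norm (measurable_fst.sub measurable_snd)).pow_const s

lemma pairQuot_congr (h : u =ᵐ[volume] v) : pairQuot s u =ᵐ[volume] pairQuot s v := by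
  filter_upwards [ae_prod_of_ae h] with z hz
  rw [pairQuot, pairQuot, diffQuot, diffQuot, hz.1, hz.2]

lemma tendsto_pairQuot {w : ℕ → Space d → ℝ}
    (h : ∀ᵐ x, Tendsto (fun n => w n x) atTop (𝓝 (u x))) :
    ∀ᵐ z, Tendsto (fun n => pairQuot s (w n) z) atTop (𝓝 (pairQuot s u z)) := by
  filter_upwards [ae_prod_of_ae h] with z hz
  exact (hz.1.sub hz.2).div_const _

end PairQuot

/-! ### Modular convergence and its relation to the norm. -/

/-- Convergence of both modulars of `w n - u` to zero. -/
def ModTendsto (g : Space d → Space d → ℝ → ℝ) (s : ℝ) (w : ℕ → Space d → ℝ) (u : Space d → ℝ) :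
    Prop :=
  Tendsto (fun n => modularHat g fun x => w n x - u x) atTop (𝓝 0) ∧
    Tendsto (fun n => modularFrac g s fun x => w n x - u x) atTop (𝓝 0)

lemma exists_pos_le_one_ofReal_le {ε : ℝ≥0∞} (hε : 0 < ε) :
    ∃ t : ℝ, 0 < t ∧ t ≤ 1 ∧ ENNReal.ofReal t ≤ ε := by
  have h1 : min ε 1 ≠ ⊤ := (min_le_right ε 1).trans_lt ENNReal.one_lt_top |>.ne
  refine ⟨(min ε 1).toReal, ENNReal.toReal_pos (lt_min hε one_pos).ne' h1, ?_, ?_⟩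
  · exact ENNReal.toReal_le_of_le_ofReal zero_le_one (by simp)
  · rw [ENNReal.ofReal_toReal h1]
    exact min_le_left _ _

/-- If `Γ (w / t) ≤ 1` with `t ≤ 1`, convexity (`h1`) gives `Γ w ≤ t`. Conversely, doubling (`h2`)
gives `Γ (w / t) ≤ C Γ w` for each fixed `t`, which is eventually at most `1`. -/
lemma tendsto_luxemburg_iff {Γ : (Space d → ℝ) → ℝ≥0∞}
    (h1 : ∀ t : ℝ, 0 < t → t ≤ 1 → ∀ u, Γ (fun x => t * u x) ≤ ENNReal.ofReal t * Γ u)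
    (h2 : ∀ c : ℝ, 1 ≤ c → ∃ C : ℝ≥0∞, C ≠ ⊤ ∧ ∀ u, Γ (fun x => c * u x) ≤ C * Γ u)
    {w : ℕ → Space d → ℝ} :
    Tendsto (fun n => luxemburg Γ (w n)) atTop (𝓝 0) ↔
      Tendsto (fun n => Γ (w n)) atTop (𝓝 0) := by
  constructor
  · intro h
    rw [ENNReal.tendsto_nhds_zero]
    intro ε hε
    obtain ⟨t₀, ht₀, ht₀1, ht₀ε⟩ := exists_pos_le_one_ofReal_le hε
    filter_upwards [h.eventually (gt_mem_nhds (ENNReal.ofReal_pos.2 ht₀))] with n hn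
    rw [luxemburg, iInf_lt_iff] at hn
    obtain ⟨t, ht⟩ := hn
    rw [iInf_lt_iff] at ht
    obtain ⟨⟨ht0, htΓ⟩, htlt⟩ := ht
    rw [ENNReal.ofReal_lt_ofReal_iff ht₀] at htlt
    have h3 := h1 t ht0 (htlt.le.trans ht₀1) fun x => w n x / t
    have e : (fun x => t * (w n x / t)) = w n := by
      funext x
      field_simp
    rw [e] at h3
    calc Γ (w n) ≤ ENNReal.ofReal t * Γ fun x => w n x / t := h3
      _ ≤ ENNReal.ofReal t * 1 := by gcongr
      _ ≤ ε := by
        rw [mul_one]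
        exact (ENNReal.ofReal_le_ofReal htlt.le).trans ht₀ε
  · intro h
    rw [ENNReal.tendsto_nhds_zero]
    intro ε hε
    obtain ⟨t, ht, ht1, htε⟩ := exists_pos_le_one_ofReal_le hε
    obtain ⟨C, hC, hΓ⟩ := h2 t⁻¹ ((one_le_inv₀ ht).2 ht1)
    have h3 := ENNReal.Tendsto.const_mul (a := C) h (Or.inr hC)
    rw [mul_zero] at h3
    filter_upwards [h3.eventually (gt_mem_nhds one_pos)] with n hn
    refine le_trans (iInf₂_le t ⟨ht, ?_⟩) htε
    have e : (fun x => w n x / t) = fun x => t⁻¹ * w n x := by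
      funext x
      rw [div_eq_inv_mul]
    rw [e]
    exact (hΓ _).trans hn.le

namespace IsKernel

variable {gl gu : ℝ} {g : Space d → Space d → ℝ → ℝ} {s : ℝ} {Ω E : Set (Space d)}

lemma modularHat_congr {u v : Space d → ℝ} (h : u =ᵐ[volume] v) :
    modularHat g u = modularHat g v :=
  modular_congr h

lemma modularFrac_congr {u v : Space d → ℝ} (h : u =ᵐ[volume] v) :
    modularFrac g s u = modularFrac g s v := by
  rw [modularFrac_eq, modularFrac_eq]
  exact modular_congr (pairQuot_congr h)

lemma tendsto_normW_iff (H : IsKernel gl gu g) {w : ℕ → Space d → ℝ} {u : Space d → ℝ} :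
    Tendsto (fun n => normW g s fun x => w n x - u x) atTop (𝓝 0) ↔ ModTendsto g s w u := by
  have e1 := tendsto_luxemburg_iff (Γ := modularHat g) (w := fun n x => w n x - u x)
    (fun t ht ht1 u => H.hat.modular_mul_le_of_le_one ht.le ht1 u)
    (fun c hc => ⟨_, ENNReal.ofReal_ne_top, fun u => H.hat.modular_mul_le hc u⟩)
  have e2 := tendsto_luxemburg_iff (Γ := modularFrac g s) (w := fun n x => w n x - u x)
    (fun t ht ht1 u => by
      rw [modularFrac_eq, modularFrac_eq, pairQuot_const_mul]
      exact H.frac.modular_mul_le_of_le_one ht.le ht1 _)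
    (fun c hc => ⟨_, ENNReal.ofReal_ne_top, fun u => by
      rw [modularFrac_eq, modularFrac_eq, pairQuot_const_mul]
      exact H.frac.modular_mul_le hc _⟩)
  rw [ModTendsto, ← e1, ← e2]
  constructor
  · intro h
    exact ⟨tendsto_of_tendsto_of_tendsto_of_le_of_le tendsto_const_nhds h (fun _ => zero_le)
        fun n => le_self_add,
      tendsto_of_tendsto_of_tendsto_of_le_of_le tendsto_const_nhds h (fun _ => zero_le)
        fun n => le_add_self⟩
  · rintro ⟨h1, h2⟩
    simpa [normW] using h1.add h2

end IsKernel

namespace ModTendsto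

variable {gl gu : ℝ} {g : Space d → Space d → ℝ → ℝ} {s : ℝ} {w w' : ℕ → Space d → ℝ}
  {u u' : Space d → ℝ}

lemma congr_right (h : ModTendsto g s w u) (huu' : u =ᵐ[volume] u') : ModTendsto g s w u' := by
  have e : ∀ n, (fun x => w n x - u x) =ᵐ[volume] fun x => w n x - u' x := by
    intro n
    filter_upwards [huu'] with x hx
    rw [hx]
  exact ⟨h.1.congr fun n => IsKernel.modularHat_congr (e n),
    h.2.congr fun n => IsKernel.modularFrac_congr (e n)⟩

lemma subseq (h : ModTendsto g s w u) {ns : ℕ → ℕ} (hns : StrictMono ns) :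
    ModTendsto g s (fun n => w (ns n)) u :=
  ⟨h.1.comp hns.tendsto_atTop, h.2.comp hns.tendsto_atTop⟩

lemma const (u : Space d → ℝ) : ModTendsto g s (fun _ => u) u := by
  constructor
  · simp [modularHat, primitiveG]
  · simp [modularFrac, primitiveG, diffQuot]

lemma const_mul (H : IsKernel gl gu g) (h : ModTendsto g s w u) (c : ℝ) :
    ModTendsto g s (fun n x => c * w n x) fun x => c * u x := by
  obtain ⟨h1, h2⟩ := h
  simp only [ModTendsto, ← mul_sub]
  simp only [modularFrac_eq, pairQuot_const_mul] at h2 ⊢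
  exact ⟨H.hat.tendsto_modular_mul c h1, H.frac.tendsto_modular_mul c h2⟩

lemma add (H : IsKernel gl gu g) (h : ModTendsto g s w u) (h' : ModTendsto g s w' u')
    (hw : ∀ n, AEMeasurable (w n)) (hu : AEMeasurable u) :
    ModTendsto g s (fun n x => w n x + w' n x) fun x => u x + u' x := by
  obtain ⟨h1, h2⟩ := h
  obtain ⟨h1', h2'⟩ := h'
  have hm : ∀ n, AEMeasurable fun x => w n x - u x := fun n => (hw n).sub hu
  simp only [ModTendsto, add_sub_add_comm]
  simp only [modularFrac_eq, pairQuot_add] at h2 h2' ⊢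
  exact ⟨H.hat.tendsto_modular_add hm h1 h1',
    H.frac.tendsto_modular_add (fun n => aemeasurable_pairQuot (hm n)) h2 h2'⟩

lemma exists_subseq_ae (H : IsKernel gl gu g) (h : ModTendsto g s w u)
    (hw : ∀ n, AEMeasurable (w n)) (hu : AEMeasurable u) :
    ∃ ns : ℕ → ℕ, StrictMono ns ∧ ∀ᵐ x, Tendsto (fun n => w (ns n) x) atTop (𝓝 (u x)) := by
  obtain ⟨ns, hns, hlim⟩ := H.hat.exists_subseq_ae_tendsto
    (f := fun n x => w n x - u x) (fun n => (hw n).sub hu) h.1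
  refine ⟨ns, hns, ?_⟩
  filter_upwards [hlim] with x hx
  exact tendsto_sub_nhds_zero_iff.1 hx

/-- Contractions act continuously, up to subsequences, for modular convergence. -/
lemma exists_subseq_comp (H : IsKernel gl gu g) (h : ModTendsto g s w u)
    (hw : ∀ n, AEMeasurable (w n)) (hu : AEMeasurable u) (hfin : modularFrac g s u < ⊤)
    {T : ℝ → ℝ} (hT : LipschitzWith 1 T) :
    ∃ ns : ℕ → ℕ, StrictMono ns ∧
      ModTendsto g s (fun n x => T (w (ns n) x)) fun x => T (u x) := by
  obtain ⟨ns, hns, hlim⟩ := h.exists_subseq_ae H hw hu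
  refine ⟨ns, hns, ?_⟩
  have hTle : ∀ a b, |T a - T b| ≤ |a - b| := fun a b => by
    have := hT.dist_le_mul a b
    rwa [NNReal.coe_one, one_mul, Real.dist_eq, Real.dist_eq] at this
  have hTm : Measurable T := hT.continuous.measurable
  have h' := h.subseq hns
  refine ⟨?_, ?_⟩
  · exact tendsto_of_tendsto_of_tendsto_of_le_of_le tendsto_const_nhds h'.1 (fun _ => zero_le)
      fun n => H.hat.modular_mono (ae_of_all _ fun x => hTle _ _)
  · have h2 := h'.2
    rw [modularFrac_eq] at hfin
    simp only [modularFrac_eq] at h2 ⊢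
    -- The quotients of `T w - T u` are not bounded by those of `w - u` alone; they are bounded by
    -- these plus `2 |δˢu|`, so generalized dominated convergence is needed, and with it the a.e.
    -- convergent subsequence.
    refine H.frac.tendsto_modular_of_dominated (b := fun z => 2 * pairQuot s u z)
      (a := fun n => pairQuot s fun x => w (ns n) x - u x)
      (fun n => aemeasurable_pairQuot ((hTm.comp_aemeasurable (hw _)).sub
        (hTm.comp_aemeasurable hu)))
      (fun n => aemeasurable_pairQuot ((hw _).sub hu)) (H.frac.modular_mul_lt_top 2 hfin) h2
      (fun n => ae_of_all _ fun z => ?_) ?_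
    · simp only [pairQuot_sub, abs_mul, abs_two]
      have h3 : |pairQuot s (fun x => T (w (ns n) x)) z| ≤ |pairQuot s (w (ns n)) z| :=
        abs_pairQuot_le_of_le (hTle _ _)
      have h4 : |pairQuot s (fun x => T (u x)) z| ≤ |pairQuot s u z| :=
        abs_pairQuot_le_of_le (hTle _ _)
      have h5 := abs_sub (pairQuot s (fun x => T (w (ns n) x)) z)
        (pairQuot s (fun x => T (u x)) z)
      have h6 : |pairQuot s (w (ns n)) z| ≤
          |pairQuot s (w (ns n)) z - pairQuot s u z| + |pairQuot s u z| := by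
        have := abs_add_le (pairQuot s (w (ns n)) z - pairQuot s u z) (pairQuot s u z)
        rwa [sub_add_cancel] at this
      linarith
    · have h3 : ∀ᵐ x, Tendsto (fun n => T (w (ns n) x)) atTop (𝓝 (T (u x))) := by
        filter_upwards [hlim] with x hx
        exact (hT.continuous.tendsto _).comp hx
      filter_upwards [tendsto_pairQuot (s := s) h3] with z hz
      simp only [pairQuot_sub]
      exact tendsto_sub_nhds_zero_iff.2 hz

/-- Diagonal sequences for modular convergence. -/
lemma exists_diagonal (H : IsKernel gl gu g) (h : ModTendsto g s w u)
    (hw : ∀ n, AEMeasurable (w n)) (hu : AEMeasurable u) {P : (Space d → ℝ) → Prop}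
    (happ : ∀ n, ∃ φ : ℕ → Space d → ℝ, (∀ k, P (φ k)) ∧ ModTendsto g s φ (w n)) :
    ∃ φ : ℕ → Space d → ℝ, (∀ k, P (φ k)) ∧ ModTendsto g s φ u := by
  have hex : ∀ n : ℕ, ∃ φ, P φ ∧ modularHat g (fun x => φ x - w n x) ≤ (n : ℝ≥0∞)⁻¹ ∧
      modularFrac g s (fun x => φ x - w n x) ≤ (n : ℝ≥0∞)⁻¹ := by
    intro n
    obtain ⟨φ, hφ, h1, h2⟩ := happ n
    have hn : (0 : ℝ≥0∞) < (n : ℝ≥0∞)⁻¹ := ENNReal.inv_pos.2 (ENNReal.natCast_ne_top n)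
    obtain ⟨k, hk1, hk2⟩ := ((h1.eventually (gt_mem_nhds hn)).and
      (h2.eventually (gt_mem_nhds hn))).exists
    exact ⟨φ k, hφ k, hk1.le, hk2.le⟩
  choose φ hφ h1 h2 using hex
  refine ⟨φ, hφ, ?_⟩
  have h3 : ModTendsto g s (fun n x => φ n x - w n x) fun _ => 0 := by
    simp only [ModTendsto, sub_zero]
    exact ⟨tendsto_of_tendsto_of_tendsto_of_le_of_le tendsto_const_nhds
        ENNReal.tendsto_inv_nat_nhds_zero (fun _ => zero_le) h1,
      tendsto_of_tendsto_of_tendsto_of_le_of_le tendsto_const_nhds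
        ENNReal.tendsto_inv_nat_nhds_zero (fun _ => zero_le) h2⟩
  have h4 := h.add H h3 hw hu
  simpa using h4

end ModTendsto

namespace IsKernel

variable {gl gu : ℝ} {g : Space d → Space d → ℝ → ℝ} {s : ℝ} {Ω E : Set (Space d)}

lemma memW0_iff (H : IsKernel gl gu g) {u : Space d → ℝ} :
    MemW0 g s Ω u ↔ MemW g s u ∧ ∃ φ : ℕ → Space d → ℝ, (∀ k, IsTest Ω (φ k)) ∧
      ModTendsto g s φ u := by
  simp only [MemW0, H.tendsto_normW_iff]

lemma geOn_iff (H : IsKernel gl gu g) {u : Space d → ℝ} {c : ℝ} :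
    GeOn g s Ω E u c ↔ ∃ w : ℕ → Space d → ℝ, (∀ k, IsLipTest Ω (w k) ∧ ∀ x ∈ E, c ≤ w k x) ∧
      ModTendsto g s w u := by
  simp only [GeOn, H.tendsto_normW_iff]

lemma leOn_iff (H : IsKernel gl gu g) {u : Space d → ℝ} {c : ℝ} :
    LeOn g s Ω E u c ↔ ∃ w : ℕ → Space d → ℝ, (∀ k, IsLipTest Ω (w k) ∧ ∀ x ∈ E, w k x ≤ c) ∧
      ModTendsto g s w u := by
  simp only [LeOn, H.tendsto_normW_iff]

lemma memW_add (H : IsKernel gl gu g) {u v : Space d → ℝ} (hu : MemW g s u) (hv : MemW g s v) :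
    MemW g s fun x => u x + v x := by
  refine ⟨hu.1.add hv.1, H.hat.modular_add_lt_top hu.1 hu.2.1 hv.2.1, ?_⟩
  have h1 := hu.2.2
  have h2 := hv.2.2
  rw [modularFrac_eq] at h1 h2 ⊢
  rw [pairQuot_add]
  exact H.frac.modular_add_lt_top (aemeasurable_pairQuot hu.1) h1 h2

lemma memW_const_mul (H : IsKernel gl gu g) {u : Space d → ℝ} (hu : MemW g s u) (c : ℝ) :
    MemW g s fun x => c * u x := by
  refine ⟨hu.1.const_mul c, H.hat.modular_mul_lt_top c hu.2.1, ?_⟩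
  have h1 := hu.2.2
  rw [modularFrac_eq] at h1 ⊢
  rw [pairQuot_const_mul]
  exact H.frac.modular_mul_lt_top c h1

lemma _root_.FracOrlicz.MemW.frac_lt_top {u : Space d → ℝ} (hu : MemW g s u) :
    modular volume (fracField g) (pairQuot s u) < ⊤ := by
  rw [← modularFrac_eq]
  exact hu.2.2

lemma integrable_integrandL (H : IsKernel gl gu g) {u v : Space d → ℝ} (hu : MemW g s u)
    (hv : MemW g s v) : Integrable (integrandL g s u v) := by
  rw [integrandL_eq]
  exact H.frac.integrable_field_mul (aemeasurable_pairQuot hu.1) (aemeasurable_pairQuot hv.1)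
    hu.frac_lt_top hv.frac_lt_top

lemma pairingL_add (H : IsKernel gl gu g) {u v v' : Space d → ℝ} (hu : MemW g s u)
    (hv : MemW g s v) (hv' : MemW g s v') :
    pairingL g s u (fun x => v x + v' x) = pairingL g s u v + pairingL g s u v' := by
  rw [pairingL, pairingL, pairingL,
    ← integral_add (H.integrable_integrandL hu hv) (H.integrable_integrandL hu hv')]
  simp only [integrandL_eq, pairQuot_add, mul_add]

lemma pairingL_const_mul (u v : Space d → ℝ) (c : ℝ) :
    pairingL g s u (fun x => c * v x) = c * pairingL g s u v := by
  rw [pairingL, pairingL, ← integral_const_mul]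
  simp only [integrandL_eq, pairQuot_const_mul]
  congr 1
  funext z
  ring

lemma pairingL_congr {u u' v v' : Space d → ℝ} (hu : u =ᵐ[volume] u') (hv : v =ᵐ[volume] v') :
    pairingL g s u v = pairingL g s u' v' := by
  refine integral_congr_ae ?_
  filter_upwards [pairQuot_congr (s := s) hu, pairQuot_congr (s := s) hv] with z h1 h2
  simp only [integrandL_eq, h1, h2]

/-! ### Lipschitz test functions and `W₀`. -/

/-- Difference quotients of Lipschitz functions supported in a fixed compact subset of `Ω` are
dominated by those of finitely many test functions. -/
lemma exists_dominating (H : IsKernel gl gu g) (hΩ : IsOpen Ω)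
    (h_test : ∀ φ, IsTest Ω φ → MemW g s φ) {K : Set (Space d)} (hK : IsCompact K) (hKΩ : K ⊆ Ω) :
    ∃ B : Space d × Space d → ℝ, modular volume (fracField g) B < ⊤ ∧
      ∀ (w : Space d → ℝ) (L M : ℝ), 0 ≤ L → 0 ≤ M → (∀ x y, |w x - w y| ≤ L * ‖x - y‖) →
        (∀ x, |w x| ≤ M) → (∀ x ∉ K, w x = 0) → ∀ z, |pairQuot s w z| ≤ |(L + M) * B z| := by
  -- Nested cut-offs: `η₂ = 1` on `K` and `η₁ = 1` on the support of `η₂`. The localized coordinates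
  -- `xᵢ η₁` and `η₂` are test functions, so their energies are finite by assumption.
  obtain ⟨η₂, hη₂, hη₂1, -⟩ := exists_isTest_eq_one hΩ hK hKΩ
  obtain ⟨η₁, hη₁, hη₁1, -⟩ := exists_isTest_eq_one hΩ hη₂.2.1 hη₂.2.2
  set φ : Fin d → Space d → ℝ := fun i x => x i * η₁ x with hφdef
  have hφ : ∀ i, IsTest Ω (φ i) := fun i => hη₁.smooth_mul (by fun_prop)
  have hmeas : ∀ u, IsTest Ω u → AEMeasurable fun z => |pairQuot s u z| := fun u hu =>
    continuous_abs.measurable.comp_aemeasurable (aemeasurable_pairQuot (h_test u hu).1)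
  have habs : ∀ u, IsTest Ω u →
      modular volume (fracField g) (fun z => |pairQuot s u z|) < ⊤ := fun u hu => by
    simpa only [modular, young_abs] using (h_test u hu).frac_lt_top
  refine ⟨fun z => |pairQuot s η₂ z| + ∑ i, |pairQuot s (φ i) z|,
    H.frac.modular_add_lt_top (hmeas _ hη₂) (habs _ hη₂)
      (H.frac.modular_sum_lt_top _ (fun i => hmeas _ (hφ i)) fun i => habs _ (hφ i)), ?_⟩
  intro w L M hL hM hwL hwM hwK z
  have key : ∀ x ∈ K, ∀ y, |w x - w y| ≤
      (L + M) * (|η₂ x - η₂ y| + ∑ i, |φ i x - φ i y|) := by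
    intro x hx y
    have hs0 : 0 ≤ ∑ i, |φ i x - φ i y| := Finset.sum_nonneg fun i _ => abs_nonneg _
    -- If `y` is in the support of `η₂`, the localized coordinates are true coordinates at both
    -- points and their differences control `|x - y|`. Otherwise `η₂ x - η₂ y = 1`, and the sup
    -- bound `M` suffices.
    by_cases hy : y ∈ tsupport η₂
    · have hx1 : η₁ x = 1 := hη₁1 x (subset_tsupport _ (by simp [hη₂1 x hx]))
      have hy1 : η₁ y = 1 := hη₁1 y hy
      have h1 : ‖x - y‖ ≤ ∑ i, |φ i x - φ i y| := by
        have h2 : ‖x - y‖ ≤ ∑ i, ‖(x - y) i‖ := by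
          have e := (EuclideanSpace.basisFun (Fin d) ℝ).sum_repr (x - y)
          calc ‖x - y‖ = ‖∑ i, (EuclideanSpace.basisFun (Fin d) ℝ).repr (x - y) i •
                EuclideanSpace.basisFun (Fin d) ℝ i‖ := by rw [e]
            _ ≤ ∑ i, ‖(EuclideanSpace.basisFun (Fin d) ℝ).repr (x - y) i •
                EuclideanSpace.basisFun (Fin d) ℝ i‖ := norm_sum_le _ _
            _ = ∑ i, ‖(x - y) i‖ := by simp [norm_smul]
        simpa [hφdef, hx1, hy1] using h2
      have h2 := (hwL x y).trans (mul_le_mul_of_nonneg_left h1 hL)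
      have h3 : 0 ≤ L * |η₂ x - η₂ y| := mul_nonneg hL (abs_nonneg _)
      have h4 : 0 ≤ M * (|η₂ x - η₂ y| + ∑ i, |φ i x - φ i y|) := by positivity
      nlinarith
    · have hyK : y ∉ K := fun hyK => hy (subset_tsupport _ (by simp [hη₂1 y hyK]))
      rw [hη₂1 x hx, image_eq_zero_of_notMem_tsupport hy, hwK y hyK, sub_zero, sub_zero, abs_one]
      have h1 := hwM x
      have h2 : 0 ≤ (L + M) * ∑ i, |φ i x - φ i y| := by positivity
      nlinarith
  have hpt : |w z.1 - w z.2| ≤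
      (L + M) * (|η₂ z.1 - η₂ z.2| + ∑ i, |φ i z.1 - φ i z.2|) := by
    by_cases h1 : z.1 ∈ K
    · exact key _ h1 _
    · by_cases h2 : z.2 ∈ K
      · have := key _ h2 z.1
        rw [abs_sub_comm, abs_sub_comm (η₂ z.1)]
        simpa only [abs_sub_comm (φ _ z.1)] using this
      · rw [hwK _ h1, hwK _ h2, sub_zero, abs_zero]
        positivity
  refine le_trans ?_ (le_abs_self _)
  simp only [abs_pairQuot]
  rw [← Finset.sum_div, ← add_div, ← mul_div_assoc]
  exact div_le_div_of_nonneg_right hpt (Real.rpow_nonneg (norm_nonneg _) s)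

lemma modularHat_lt_top_of_le (H : IsKernel gl gu g) (h_one : modularHat g (Ω.indicator 1) < ⊤)
    {w : Space d → ℝ} {M : ℝ} (hM : ∀ x, |w x| ≤ M) (hw : ∀ x ∉ Ω, w x = 0) :
    modularHat g w < ⊤ := by
  refine lt_of_le_of_lt (H.hat.modular_mono (g := fun x => M * Ω.indicator 1 x)
    (ae_of_all _ fun x => ?_)) (H.hat.modular_mul_lt_top M h_one)
  by_cases hx : x ∈ Ω
  · simpa [hx] using (hM x).trans (le_abs_self M)
  · simp [hx, hw x hx]

/-- Dominated convergence for the modular `modularHat` and functions vanishing outside `Ω`. -/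
lemma tendsto_modularHat (H : IsKernel gl gu g) (h_one : modularHat g (Ω.indicator 1) < ⊤)
    {w : ℕ → Space d → ℝ} {M : ℝ} (hwm : ∀ n, AEMeasurable (w n))
    (hM : ∀ n x, |w n x| ≤ M) (hw : ∀ n, ∀ x ∉ Ω, w n x = 0)
    (hlim : ∀ᵐ x, Tendsto (fun n => w n x) atTop (𝓝 0)) :
    Tendsto (fun n => modularHat g (w n)) atTop (𝓝 0) := by
  refine H.hat.tendsto_modular_of_dominated (a := fun _ _ => 0)
    (b := fun x => M * Ω.indicator 1 x) hwm (fun _ => aemeasurable_const)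
    (H.hat.modular_mul_lt_top M h_one) ?_ (fun n => ae_of_all _ fun x => ?_) hlim
  · simp [GrowthField.modular_zero]
  · by_cases hx : x ∈ Ω
    · simpa [hx] using (hM n x).trans (le_abs_self M)
    · simp [hx, hw n x hx]

lemma _root_.FracOrlicz.IsLipTest.exists_bound {w : Space d → ℝ} (hw : IsLipTest Ω w) :
    ∃ M : ℝ, 0 ≤ M ∧ ∀ x, |w x| ≤ M := by
  obtain ⟨C, hC⟩ := hw.2.1.exists_bound_of_continuous hw.continuous
  exact ⟨max C 0, le_max_right _ _, fun x => (hC x).trans (le_max_left _ _)⟩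

/-- Lipschitz functions with compact support in `Ω` belong to `W₀^{s,G}(Ω)`. -/
lemma memW0_of_isLipTest (H : IsKernel gl gu g) (hΩ : IsOpen Ω)
    (h_test : ∀ φ, IsTest Ω φ → MemW g s φ) (h_one : modularHat g (Ω.indicator 1) < ⊤)
    {w : Space d → ℝ} (hw : IsLipTest Ω w) : MemW0 g s Ω w := by
  obtain ⟨M, hM0, hM⟩ := hw.exists_bound
  obtain ⟨L, hL⟩ := hw.1
  obtain ⟨K, hKΩ, hK, hwK, φ, hφ, hφL, hφM, hφK, hlim⟩ :=
    IsLipTest.exists_mollified hΩ hL hM hw.2.1 hw.2.2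
  obtain ⟨B, hB, hdom⟩ := H.exists_dominating hΩ h_test hK hKΩ
  have hwL : ∀ x y, |w x - w y| ≤ L * ‖x - y‖ := fun x y => by
    have := hL.dist_le_mul x y
    rwa [Real.dist_eq, dist_eq_norm] at this
  have hwK0 : ∀ x ∉ K, w x = 0 := fun x hx =>
    image_eq_zero_of_notMem_tsupport fun hx' => hx (hwK hx')
  have hwm : AEMeasurable w := hw.continuous.measurable.aemeasurable
  have hφm : ∀ n, AEMeasurable (φ n) := fun n => (h_test _ (hφ n)).1
  have hlim0 : ∀ x, Tendsto (fun n => φ n x - w x) atTop (𝓝 0) := fun x =>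
    tendsto_sub_nhds_zero_iff.2 (hlim x)
  refine H.memW0_iff.2 ⟨⟨hwm, H.modularHat_lt_top_of_le h_one hM fun x hx => hw.eq_zero hx, ?_⟩,
    φ, hφ, ?_, ?_⟩
  · rw [modularFrac_eq]
    exact lt_of_le_of_lt (H.frac.modular_mono
      (ae_of_all _ (hdom w L M L.2 hM0 hwL hM hwK0))) (H.frac.modular_mul_lt_top _ hB)
  · refine H.tendsto_modularHat h_one (M := M + M) (fun n => (hφm n).sub hwm)
      (fun n x => ?_) (fun n x hx => ?_) (ae_of_all _ hlim0)
    · exact (abs_sub _ _).trans (add_le_add (hφM n x) (hM x))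
    · rw [(hφ n).isLipTest.eq_zero hx, hw.eq_zero hx, sub_zero]
  · simp only [modularFrac_eq]
    refine H.frac.tendsto_modular_of_dominated (a := fun _ _ => 0)
      (b := fun z => ((L + L : ℝ) + (M + M)) * B z)
      (fun n => aemeasurable_pairQuot ((hφm n).sub hwm)) (fun _ => aemeasurable_const)
      (H.frac.modular_mul_lt_top _ hB) ?_ (fun n => ae_of_all _ fun z => ?_) ?_
    · simp [GrowthField.modular_zero]
    · rw [abs_zero, zero_add]
      refine hdom _ (L + L) (M + M) (by positivity) (by positivity) (fun x y => ?_) (fun x => ?_)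
        (fun x hx => ?_) z
      · have h1 := hφL n x y
        have h2 := hwL x y
        have h3 := abs_sub (φ n x - φ n y) (w x - w y)
        have e : φ n x - w x - (φ n y - w y) = φ n x - φ n y - (w x - w y) := by ring
        rw [e]
        linarith
      · exact (abs_sub _ _).trans (add_le_add (hφM n x) (hM x))
      · rw [hφK n x hx, hwK0 x hx, sub_zero]
    · have h0 : pairQuot s (fun _ : Space d => (0 : ℝ)) = fun _ => 0 := by
        funext z
        simp [pairQuot, diffQuot]
      have := tendsto_pairQuot (s := s) (ae_of_all _ hlim0)
      simpa only [h0] using this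

/-- A function of `W^{s,G}` approximated by Lipschitz functions belongs to `𝕂_E`. -/
lemma memK_of_modTendsto (H : IsKernel gl gu g) (hΩ : IsOpen Ω)
    (h_test : ∀ φ, IsTest Ω φ → MemW g s φ) (h_one : modularHat g (Ω.indicator 1) < ⊤)
    {w : ℕ → Space d → ℝ} {u : Space d → ℝ} (hu : MemW g s u)
    (hw : ∀ n, IsLipTest Ω (w n) ∧ ∀ x ∈ E, 1 ≤ w n x) (hwu : ModTendsto g s w u) :
    MemK g s Ω E u := by
  refine ⟨H.memW0_iff.2 ⟨hu, ?_⟩, H.geOn_iff.2 ⟨w, hw, hwu⟩⟩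
  exact hwu.exists_diagonal H (fun n => (hw n).1.continuous.measurable.aemeasurable) hu.1
    fun n => (H.memW0_iff.1 (H.memW0_of_isLipTest hΩ h_test h_one (hw n).1)).2

/-- Functions of `W₀^{s,G}(Ω)` vanish almost everywhere outside `Ω`. -/
lemma ae_eq_zero_of_memW0 (H : IsKernel gl gu g) (h_test : ∀ φ, IsTest Ω φ → MemW g s φ)
    {u : Space d → ℝ} (hu : MemW0 g s Ω u) : ∀ᵐ x, x ∉ Ω → u x = 0 := by
  obtain ⟨huW, φ, hφ, hφu⟩ := H.memW0_iff.1 hu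
  obtain ⟨ns, -, hlim⟩ := hφu.exists_subseq_ae H (fun n => (h_test _ (hφ n)).1) huW.1
  filter_upwards [hlim] with x hx hxΩ
  refine tendsto_nhds_unique hx ?_
  simp only [(hφ _).isLipTest.eq_zero hxΩ]
  exact tendsto_const_nhds

end IsKernel

end FracOrlicz

end

/-! ### Recovering functions from differences; compactness of Cauchy sequences. -/

noncomputable section

namespace FracOrlicz

variable {d : ℕ}

namespace IsKernel

variable {gl gu : ℝ} {g : Space d → Space d → ℝ → ℝ} {s : ℝ} {Ω E : Set (Space d)}

/-- A bounded set has finite measure, the whole space infinite measure. This supplies base points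
`y` at which all competitors vanish. -/
lemma frequently_notMem (hd : 0 < d) (hΩ : Bornology.IsBounded Ω) :
    ∃ᶠ y : Space d in ae volume, y ∉ Ω := by
  have : Nonempty (Fin d) := ⟨⟨0, hd⟩⟩
  intro hcon
  have h1 : volume (univ : Set (Space d)) ≤ volume Ω := by
    refine measure_mono_ae ?_
    filter_upwards [hcon] with y hy _
    exact not_not.1 hy
  rw [measure_univ_of_isAddLeftInvariant] at h1
  exact absurd hΩ.measure_lt_top (not_lt.2 h1)

/-- A property of differences along which a.e. pair is controlled gives a property of a.e. value,
for functions vanishing outside a bounded set. -/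
lemma exists_ae_notMem (hd : 0 < d) (hΩ : Bornology.IsBounded Ω) {P : Space d → Space d → Prop}
    {Q : Space d → Prop} (hP : ∀ᵐ z : Space d × Space d, P z.1 z.2) (hQ : ∀ᵐ y, y ∉ Ω → Q y) :
    ∀ᵐ x, ∃ y, y ∉ Ω ∧ Q y ∧ P x y := by
  rw [Measure.volume_eq_prod] at hP
  filter_upwards [Measure.ae_ae_of_ae_prod hP] with x hx
  obtain ⟨y, hy, h1, h2⟩ := ((frequently_notMem hd hΩ).and_eventually (hx.and hQ)).exists
  exact ⟨y, hy, h2 hy, h1⟩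

lemma sub_eq_pairQuot_mul {u : Space d → ℝ} {s : ℝ} {z : Space d × Space d} (hz : z.1 ≠ z.2) :
    u z.1 - u z.2 = pairQuot s u z * ‖z.1 - z.2‖ ^ s := by
  have := (Real.rpow_pos_of_pos (norm_pos_iff.2 (sub_ne_zero.2 hz)) s).ne'
  rw [pairQuot, diffQuot]
  field_simp

/-- Functions vanishing outside a bounded set are determined by their difference quotients. -/
lemma ae_eq_of_pairQuot (hd : 0 < d) (hΩ : Bornology.IsBounded Ω) {u v : Space d → ℝ}
    (hu : ∀ᵐ x, x ∉ Ω → u x = 0) (hv : ∀ᵐ x, x ∉ Ω → v x = 0)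
    (huv : pairQuot s u =ᵐ[volume] pairQuot s v) : u =ᵐ[volume] v := by
  have h1 : ∀ᵐ z : Space d × Space d, u z.1 - u z.2 = v z.1 - v z.2 := by
    filter_upwards [huv, ae_fst_ne_snd hd] with z hz hne
    rw [sub_eq_pairQuot_mul (u := u) (s := s) hne, sub_eq_pairQuot_mul (u := v) (s := s) hne, hz]
  have h2 : ∀ᵐ y, y ∉ Ω → u y = 0 ∧ v y = 0 := by
    filter_upwards [hu, hv] with y h3 h4 h5
    exact ⟨h3 h5, h4 h5⟩
  filter_upwards [exists_ae_notMem hd hΩ (P := fun x y => u x - u y = v x - v y) h1 h2]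
    with x ⟨y, _, ⟨hy1, hy2⟩, hxy⟩
  rwa [hy1, hy2, sub_zero, sub_zero] at hxy

lemma memW_of_isLipTest (H : IsKernel gl gu g) (hΩ : IsOpen Ω)
    (h_test : ∀ φ, IsTest Ω φ → MemW g s φ) (h_one : modularHat g (Ω.indicator 1) < ⊤)
    {w : Space d → ℝ} (hw : IsLipTest Ω w) : MemW g s w :=
  (H.memW0_of_isLipTest hΩ h_test h_one hw).1

/-- A sequence which is Cauchy for the fractional modular has a subsequence converging a.e. -/
lemma exists_subseq_ae_of_cauchy (H : IsKernel gl gu g) (hd : 0 < d)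
    (hΩ : Bornology.IsBounded Ω) {w : ℕ → Space d → ℝ} (hwm : ∀ n, AEMeasurable (w n))
    (hwΩ : ∀ n, ∀ x ∉ Ω, w n x = 0)
    (hc : ∀ δ : ℝ, 0 < δ → ∃ N, ∀ n ≥ N, ∀ l ≥ N,
      modularFrac g s (fun x => w n x - w l x) ≤ ENNReal.ofReal δ) :
    ∃ ns : ℕ → ℕ, StrictMono ns ∧
      ∀ᵐ x, ∃ a, Tendsto (fun n => w (ns n) x) atTop (𝓝 a) := by
  -- The denominator compensates the doubling constant for multiplication by `2 ^ n`, leaving `2 ^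
  -- (-n)` as required by `ae_summable`.
  set η : ℕ → ℝ := fun n => (2⁻¹ : ℝ) ^ n / ((2 : ℝ) ^ n) ^ (gu + 1) with hη
  have hη0 : ∀ n, 0 < η n := fun n => by positivity
  obtain ⟨ns, hns, hns'⟩ := extraction_forall_of_eventually'
    (P := fun n k => ∀ l ≥ k, modularFrac g s (fun x => w l x - w k x) ≤ ENNReal.ofReal (η n))
    fun n => by
      obtain ⟨N, hN⟩ := hc (η n) (hη0 n)
      exact ⟨N, fun k hk l hl => hN l (hk.trans hl) k hk⟩
  refine ⟨ns, hns, ?_⟩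
  have hsum := H.frac.ae_summable (f := fun n => pairQuot s fun x => w (ns (n + 1)) x - w (ns n) x)
    (fun n => aemeasurable_pairQuot ((hwm _).sub (hwm _))) fun n => by
      refine (H.frac.modular_mul_le (one_le_pow₀ one_le_two) _).trans ?_
      have h1 := hns' n (ns (n + 1)) (hns (Nat.lt_succ_self n)).le
      rw [modularFrac_eq] at h1
      refine (mul_le_mul_right h1 _).trans ?_
      rw [← ENNReal.ofReal_mul (by positivity), hη]
      have e : ((2 : ℝ) ^ n) ^ (gu + 1) * ((2⁻¹ : ℝ) ^ n / ((2 : ℝ) ^ n) ^ (gu + 1)) =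
          (2⁻¹ : ℝ) ^ n := by
        have : (((2 : ℝ) ^ n) ^ (gu + 1)) ≠ 0 := by positivity
        field_simp
      simp only [e]
      rw [ENNReal.ofReal_pow (by positivity), ENNReal.ofReal_inv_of_pos two_pos,
        ENNReal.ofReal_ofNat]
  have hlim : ∀ᵐ z : Space d × Space d,
      ∃ a, Tendsto (fun n => w (ns n) z.1 - w (ns n) z.2) atTop (𝓝 a) := by
    filter_upwards [hsum, ae_fst_ne_snd hd] with z hz hne
    have h1 := hz.hasSum.tendsto_sum_nat
    simp only [pairQuot_sub] at h1
    simp only [Finset.sum_range_sub (fun n => pairQuot s (w (ns n)) z)] at h1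
    have h2 := (h1.add_const (pairQuot s (w (ns 0)) z)).mul_const (‖z.1 - z.2‖ ^ s)
    refine ⟨_, h2.congr fun n => ?_⟩
    rw [sub_add_cancel, sub_eq_pairQuot_mul (s := s) hne]
  filter_upwards [exists_ae_notMem hd hΩ
    (P := fun x y => ∃ a, Tendsto (fun n => w (ns n) x - w (ns n) y) atTop (𝓝 a)) hlim
    (ae_of_all _ fun y (_ : y ∉ Ω) => trivial)] with x ⟨y, hy, _, a, ha⟩
  refine ⟨a, ha.congr fun n => ?_⟩
  rw [hwΩ _ y hy, sub_zero]

/-- Bounded sequences of functions vanishing outside `Ω` which are Cauchy for the fractional modular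
have modular limits along a subsequence. -/
lemma exists_modTendsto_of_cauchy (H : IsKernel gl gu g) (hd : 0 < d)
    (hΩ : Bornology.IsBounded Ω) (h_one : modularHat g (Ω.indicator 1) < ⊤)
    {w : ℕ → Space d → ℝ} (hwW : ∀ n, MemW g s (w n)) (hwΩ : ∀ n, ∀ x ∉ Ω, w n x = 0)
    (hw1 : ∀ n x, |w n x| ≤ 1)
    (hc : ∀ δ : ℝ, 0 < δ → ∃ N, ∀ n ≥ N, ∀ l ≥ N,
      modularFrac g s (fun x => w n x - w l x) ≤ ENNReal.ofReal δ) :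
    ∃ ns : ℕ → ℕ, StrictMono ns ∧ ∃ u, MemW g s u ∧ ModTendsto g s (fun n => w (ns n)) u ∧
      ∀ᵐ x, Tendsto (fun n => w (ns n) x) atTop (𝓝 (u x)) := by
  have hwm : ∀ n, AEMeasurable (w n) := fun n => (hwW n).1
  obtain ⟨ns, hns, hlim⟩ := H.exists_subseq_ae_of_cauchy hd hΩ hwm hwΩ hc
  -- The limit is set to `0` where the subsequence diverges, so that `|u| ≤ 1` and `u = 0` off `Ω`
  -- hold everywhere, not just a.e.
  have hex : ∀ x, ∃ a : ℝ, |a| ≤ 1 ∧ (x ∉ Ω → a = 0) ∧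
      ((∃ a, Tendsto (fun n => w (ns n) x) atTop (𝓝 a)) →
        Tendsto (fun n => w (ns n) x) atTop (𝓝 a)) := by
    intro x
    by_cases hx : ∃ a, Tendsto (fun n => w (ns n) x) atTop (𝓝 a)
    · obtain ⟨a, ha⟩ := hx
      refine ⟨a, le_of_tendsto' ha.abs fun n => hw1 _ x, fun hxΩ => ?_, fun _ => ha⟩
      refine tendsto_nhds_unique ha ?_
      simp only [hwΩ _ x hxΩ]
      exact tendsto_const_nhds
    · exact ⟨0, by simp, fun _ => rfl, fun h => absurd h hx⟩
  choose u hu1 huΩ hulim using hex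
  have hlim' : ∀ᵐ x, Tendsto (fun n => w (ns n) x) atTop (𝓝 (u x)) := by
    filter_upwards [hlim] with x hx
    exact hulim x hx
  have hum : AEMeasurable u := aemeasurable_of_tendsto_metrizable_ae atTop (fun n => hwm _) hlim'
  have hhat : Tendsto (fun n => modularHat g fun x => w (ns n) x - u x) atTop (𝓝 0) := by
    refine H.tendsto_modularHat h_one (M := 1 + 1) (fun n => (hwm _).sub hum) (fun n x => ?_)
      (fun n x hx => ?_) ?_
    · exact (abs_sub _ _).trans (add_le_add (hw1 _ x) (hu1 x))
    · rw [hwΩ _ x hx, huΩ x hx, sub_zero]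
    · filter_upwards [hlim'] with x hx
      exact tendsto_sub_nhds_zero_iff.2 hx
  have hfrac : ∀ δ : ℝ, 0 < δ → ∃ N, ∀ n ≥ N,
      modularFrac g s (fun x => w (ns n) x - u x) ≤ ENNReal.ofReal δ := by
    intro δ hδ
    obtain ⟨N, hN⟩ := hc δ hδ
    refine ⟨N, fun n hn => ?_⟩
    rw [modularFrac_eq]
    -- Fatou's lemma in the second index of the Cauchy condition.
    refine H.frac.modular_le_of_tendsto
      (f := fun l => pairQuot s fun x => w (ns n) x - w (ns l) x)
      (fun l => aemeasurable_pairQuot ((hwm _).sub (hwm _))) ?_ ?_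
    · filter_upwards [eventually_ge_atTop N] with l hl
      rw [← modularFrac_eq]
      exact hN _ (hn.trans hns.le_apply) _ (hl.trans hns.le_apply)
    · refine tendsto_pairQuot ?_
      filter_upwards [hlim'] with x hx
      exact hx.const_sub _
  have hfrac' : Tendsto (fun n => modularFrac g s fun x => w (ns n) x - u x) atTop (𝓝 0) := by
    rw [ENNReal.tendsto_nhds_zero]
    intro ε hε
    obtain ⟨t, ht, -, htε⟩ := exists_pos_le_one_ofReal_le hε
    obtain ⟨N, hN⟩ := hfrac t ht
    filter_upwards [eventually_ge_atTop N] with n hn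
    exact (hN n hn).trans htε
  refine ⟨ns, hns, u, ⟨hum, H.modularHat_lt_top_of_le h_one hu1 huΩ, ?_⟩, ⟨hhat, hfrac'⟩, hlim'⟩
  obtain ⟨N, hN⟩ := hfrac 1 one_pos
  have h1 := hN N le_rfl
  rw [modularFrac_eq] at h1 ⊢
  have h2 := H.frac.modular_add_lt_top (aemeasurable_pairQuot (hwm (ns N))) (hwW (ns N)).frac_lt_top
    (H.frac.modular_mul_lt_top (-1) (h1.trans_lt ENNReal.ofReal_lt_top))
  simpa [pairQuot_sub] using h2

/-- The class of admissible Lipschitz functions. -/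
def _root_.FracOrlicz.lipClass (Ω E : Set (Space d)) : Set (Space d → ℝ) :=
  {w | IsLipTest Ω w ∧ ∀ x ∈ E, 1 ≤ w x}

/-- Truncation to `[0, 1]`. -/
def _root_.FracOrlicz.unitTrunc (r : ℝ) : ℝ := max (min r 1) 0

lemma _root_.FracOrlicz.lipschitzWith_unitTrunc : LipschitzWith 1 unitTrunc :=
  (LipschitzWith.id.min_const 1).max_const 0

lemma _root_.FracOrlicz.unitTrunc_zero : unitTrunc 0 = 0 := by simp [unitTrunc]

lemma _root_.FracOrlicz.unitTrunc_of_one_le {r : ℝ} (hr : 1 ≤ r) : unitTrunc r = 1 := by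
  simp [unitTrunc, hr]

lemma _root_.FracOrlicz.abs_unitTrunc_le (r : ℝ) : |unitTrunc r| ≤ 1 := by
  rw [unitTrunc, abs_of_nonneg (le_max_right _ _)]
  exact max_le (min_le_right _ _) zero_le_one

/-- Truncation is a contraction, so it shrinks every difference quotient. Minimizing sequences may
therefore take values in `[0, 1]` and be equal to `1` on `E`. -/
lemma modularFrac_unitTrunc_le (H : IsKernel gl gu g) (w : Space d → ℝ) :
    modularFrac g s (fun x => unitTrunc (w x)) ≤ modularFrac g s w := by
  rw [modularFrac_eq, modularFrac_eq]
  refine H.frac.modular_mono (ae_of_all _ fun z => abs_pairQuot_le_of_le ?_)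
  have := lipschitzWith_unitTrunc.dist_le_mul (w z.1) (w z.2)
  rwa [NNReal.coe_one, one_mul, Real.dist_eq, Real.dist_eq] at this

lemma _root_.FracOrlicz.lipClass_nonempty (hΩ : IsOpen Ω) (hE : IsCompact E) (hEΩ : E ⊆ Ω) :
    (lipClass Ω E).Nonempty := by
  obtain ⟨η, hη, hη1, -⟩ := exists_isTest_eq_one hΩ hE hEΩ
  exact ⟨η, hη.isLipTest, fun x hx => (hη1 x hx).ge⟩

/-! ### The minimization problem, the variational inequality and uniqueness. -/

/-- Minimizing sequences of uniformly convex modulars on midpoint convex sets are Cauchy. -/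
lemma cauchy_of_minimizing (H : IsKernel gl gu g) {S : Set (Space d → ℝ)}
    (hS : ∀ v ∈ S, MemW g s v) (hmid : ∀ v ∈ S, ∀ w ∈ S, (fun x => (1 / 2) * (v x + w x)) ∈ S)
    {w : ℕ → Space d → ℝ} (hw : ∀ n, w n ∈ S)
    (hlim : Tendsto (fun n => modularFrac g s (w n)) atTop (𝓝 (sInf (modularFrac g s '' S)))) :
    ∀ δ : ℝ, 0 < δ → ∃ N, ∀ n ≥ N, ∀ l ≥ N,
      modularFrac g s (fun x => w n x - w l x) ≤ ENNReal.ofReal δ := by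
  set m := sInf (modularFrac g s '' S) with hm
  have hfin : ∀ n, modularFrac g s (w n) ≠ ⊤ := fun n => (hS _ (hw n)).2.2.ne
  have hmle : ∀ v ∈ S, m ≤ modularFrac g s v := fun v hv => sInf_le (mem_image_of_mem _ hv)
  have hmtop : m ≠ ⊤ := ((hmle _ (hw 0)).trans_lt (hS _ (hw 0)).2.2).ne
  have hlim' := (ENNReal.tendsto_toReal hmtop).comp hlim
  intro δ hδ
  set M := m.toReal with hM
  have hM0 : 0 ≤ M := ENNReal.toReal_nonneg
  -- Eventually the energies are below `M + 1`, so this `ε` makes the first term at most `δ / 2`.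
  -- The midpoint has energy at least `M`, so the defect is at most twice the excess over `M`, and
  -- the second term is at most `δ / 2` too.
  obtain ⟨C, hC0, hC⟩ := H.frac.exists_modular_uniformConvexity (ε := δ / (4 * (M + 1)))
    (by positivity)
  have hη : 0 < min 1 (δ / (4 * (C + 1))) := by positivity
  obtain ⟨N, hN⟩ := eventually_atTop.1 (hlim'.eventually (gt_mem_nhds (lt_add_of_pos_right M hη)))
  refine ⟨N, fun n hn l hl => ?_⟩
  have hWn := hS _ (hw n)
  have hWl := hS _ (hw l)
  have hsub : MemW g s fun x => w n x - w l x := by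
    have := H.memW_add hWn (H.memW_const_mul hWl (-1))
    simpa [sub_eq_add_neg] using this
  have h1 := hC _ _ (aemeasurable_pairQuot hWn.1) (aemeasurable_pairQuot hWl.1) hWn.frac_lt_top
    hWl.frac_lt_top
  have hmidS := hmid _ (hw n) _ (hw l)
  have e : (fun z => (pairQuot s (w n) z + pairQuot s (w l) z) / 2) =
      pairQuot s fun x => (1 / 2) * (w n x + w l x) := by
    rw [pairQuot_const_mul, pairQuot_add]
    funext z
    ring
  rw [e, ← pairQuot_sub] at h1
  simp only [← modularFrac_eq] at h1
  have h2 : M ≤ (modularFrac g s fun x => (1 / 2) * (w n x + w l x)).toReal :=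
    ENNReal.toReal_mono (hS _ hmidS).2.2.ne (hmle _ hmidS)
  have an := hN n hn
  have al := hN l hl
  simp only [Function.comp_apply] at an al
  set a := (modularFrac g s (w n)).toReal
  set b := (modularFrac g s (w l)).toReal
  set c := (modularFrac g s fun x => (1 / 2) * (w n x + w l x)).toReal
  have hη1 : min 1 (δ / (4 * (C + 1))) ≤ 1 := min_le_left _ _
  have hη2 : min 1 (δ / (4 * (C + 1))) ≤ δ / (4 * (C + 1)) := min_le_right _ _
  have h3 : δ / (4 * (M + 1)) * (a + b) ≤ δ / 2 := by
    have : a + b ≤ 2 * (M + 1) := by linarith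
    calc δ / (4 * (M + 1)) * (a + b) ≤ δ / (4 * (M + 1)) * (2 * (M + 1)) := by gcongr
      _ = δ / 2 := by
        field_simp
        norm_num
  have h4 : C * (a + b - 2 * c) ≤ δ / 2 := by
    have h5 : a + b - 2 * c ≤ 2 * (δ / (4 * (C + 1))) := by linarith
    calc C * (a + b - 2 * c) ≤ C * (2 * (δ / (4 * (C + 1)))) := by gcongr
      _ ≤ (C + 1) * (2 * (δ / (4 * (C + 1)))) := by
        gcongr
        linarith
      _ = δ / 2 := by
        field_simp
        norm_num
  rw [← ENNReal.ofReal_toReal hsub.2.2.ne]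
  exact ENNReal.ofReal_le_ofReal (by linarith)

/-- Existence of a minimizer of the fractional modular on `𝕂_E`. -/
lemma exists_minimizer (H : IsKernel gl gu g) (hd : 0 < d) (hΩ : IsOpen Ω)
    (hΩb : Bornology.IsBounded Ω) (h_test : ∀ φ, IsTest Ω φ → MemW g s φ)
    (h_one : modularHat g (Ω.indicator 1) < ⊤) (hE : IsCompact E) (hEΩ : E ⊆ Ω) :
    ∃ u, MemW g s u ∧ (∃ w : ℕ → Space d → ℝ,
      (∀ n, IsLipTest Ω (w n) ∧ ∀ x ∈ E, w n x = 1) ∧ ModTendsto g s w u) ∧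
      ∀ v, MemK g s Ω E v → modularFrac g s u ≤ modularFrac g s v := by
  have hLW : ∀ v ∈ lipClass Ω E, MemW g s v := fun v hv => H.memW_of_isLipTest hΩ h_test h_one hv.1
  obtain ⟨a, -, ha, haS⟩ := exists_seq_tendsto_sInf
    ((lipClass_nonempty hΩ hE hEΩ).image (modularFrac g s)) (OrderBot.bddBelow _)
  choose w₀ hw₀ hw₀a using haS
  set w : ℕ → Space d → ℝ := fun n x => unitTrunc (w₀ n x) with hw
  have hwL : ∀ n, IsLipTest Ω (w n) ∧ ∀ x ∈ E, w n x = 1 := fun n =>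
    ⟨(hw₀ n).1.comp lipschitzWith_unitTrunc unitTrunc_zero,
      fun x hx => unitTrunc_of_one_le ((hw₀ n).2 x hx)⟩
  have hwS : ∀ n, w n ∈ lipClass Ω E := fun n => ⟨(hwL n).1, fun x hx => ((hwL n).2 x hx).ge⟩
  have hlim : Tendsto (fun n => modularFrac g s (w n)) atTop
      (𝓝 (sInf (modularFrac g s '' lipClass Ω E))) := by
    refine tendsto_of_tendsto_of_tendsto_of_le_of_le tendsto_const_nhds ha
      (fun n => sInf_le (mem_image_of_mem _ (hwS n))) fun n => ?_
    rw [← hw₀a n]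
    exact H.modularFrac_unitTrunc_le _
  have hmid : ∀ v ∈ lipClass Ω E, ∀ w ∈ lipClass Ω E,
      (fun x => (1 / 2) * (v x + w x)) ∈ lipClass Ω E := fun v hv w hw =>
    ⟨(hv.1.add hw.1).const_mul _, fun x hx => by linarith [hv.2 x hx, hw.2 x hx]⟩
  obtain ⟨ns, hns, u, huW, hu, hulim⟩ := H.exists_modTendsto_of_cauchy hd hΩb h_one
    (fun n => hLW _ (hwS n)) (fun n x hx => (hwL n).1.eq_zero hx)
    (fun n x => abs_unitTrunc_le _) (H.cauchy_of_minimizing hLW hmid hwS hlim)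
  refine ⟨u, huW, ⟨fun n => w (ns n), fun n => hwL _, hu⟩, fun v hv => ?_⟩
  -- Fatou's lemma bounds the energy of `u` by the infimum over the Lipschitz class; that infimum is
  -- then compared with elements of `𝕂_E`, which are modular limits of the class.
  have h1 : modularFrac g s u ≤ sInf (modularFrac g s '' lipClass Ω E) := by
    refine le_of_forall_gt_imp_ge_of_dense fun M hM => ?_
    rw [modularFrac_eq]
    refine H.frac.modular_le_of_tendsto (f := fun n => pairQuot s (w (ns n)))
      (fun n => aemeasurable_pairQuot (hLW _ (hwS _)).1) ?_ (tendsto_pairQuot hulim)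
    filter_upwards [(hlim.comp hns.tendsto_atTop).eventually (gt_mem_nhds hM)] with n hn
    rw [← modularFrac_eq]
    exact hn.le
  refine h1.trans ?_
  obtain ⟨w', hw', hw'v⟩ := H.geOn_iff.1 hv.2
  have h2 := hw'v.2
  simp only [modularFrac_eq g s fun x => w' _ x - v x, pairQuot_sub] at h2
  rw [modularFrac_eq g s v]
  refine H.frac.le_modular_of_tendsto (aemeasurable_pairQuot hv.1.1.1) (fun n => ?_) h2
  rw [← modularFrac_eq]
  exact sInf_le (mem_image_of_mem _ (hw' n))

lemma _root_.FracOrlicz.MemK.memW {u : Space d → ℝ} (hu : MemK g s Ω E u) : MemW g s u := hu.1.1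

lemma memW_sub (H : IsKernel gl gu g) {u v : Space d → ℝ} (hu : MemW g s u) (hv : MemW g s v) :
    MemW g s fun x => u x - v x := by
  have := H.memW_add hu (H.memW_const_mul hv (-1))
  simpa [sub_eq_add_neg] using this

/-- Convexity of `𝕂_E`. -/
lemma memK_segment (H : IsKernel gl gu g) (hΩ : IsOpen Ω)
    (h_test : ∀ φ, IsTest Ω φ → MemW g s φ) (h_one : modularHat g (Ω.indicator 1) < ⊤)
    {u v : Space d → ℝ} (hu : MemK g s Ω E u) (hv : MemK g s Ω E v) {t : ℝ} (ht0 : 0 ≤ t)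
    (ht1 : t ≤ 1) : MemK g s Ω E fun x => u x + t * (v x - u x) := by
  obtain ⟨w, hw, hwu⟩ := H.geOn_iff.1 hu.2
  obtain ⟨w', hw', hwv⟩ := H.geOn_iff.1 hv.2
  have h1 := (hwu.const_mul H (1 - t)).add H (hwv.const_mul H t)
    (fun n => ((hw n).1.continuous.measurable.aemeasurable).const_mul _) (hu.memW.1.const_mul _)
  have e : (fun x => (1 - t) * u x + t * v x) = fun x => u x + t * (v x - u x) := by
    funext x
    ring
  rw [e] at h1
  refine H.memK_of_modTendsto hΩ h_test h_one
    (H.memW_add hu.memW (H.memW_const_mul (H.memW_sub hv.memW hu.memW) t)) (fun n => ?_) h1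
  refine ⟨((hw n).1.const_mul _).add ((hw' n).1.const_mul _), fun x hx => ?_⟩
  have h2 := mul_le_mul_of_nonneg_left ((hw n).2 x hx) (sub_nonneg.2 ht1)
  have h3 := mul_le_mul_of_nonneg_left ((hw' n).2 x hx) ht0
  linarith

/-- Minimizers are capacitary potentials. -/
lemma isCapacitaryPotential_of_minimizer (H : IsKernel gl gu g) (hΩ : IsOpen Ω)
    (h_test : ∀ φ, IsTest Ω φ → MemW g s φ) (h_one : modularHat g (Ω.indicator 1) < ⊤)
    {u : Space d → ℝ} (hu : MemK g s Ω E u)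
    (hmin : ∀ v, MemK g s Ω E v → modularFrac g s u ≤ modularFrac g s v) :
    IsCapacitaryPotential g s Ω E u := by
  refine ⟨hu, fun v hv => ?_⟩
  have hvu := H.memW_sub hv.memW hu.memW
  rw [pairingL, integrandL_eq]
  refine H.frac.integral_field_mul_nonneg (aemeasurable_pairQuot hu.memW.1)
    (aemeasurable_pairQuot hvu.1) hu.memW.frac_lt_top hvu.frac_lt_top fun t ht0 ht1 => ?_
  have := hmin _ (H.memK_segment hΩ h_test h_one hu hv ht0.le ht1)
  rwa [modularFrac_eq, modularFrac_eq, pairQuot_add, pairQuot_const_mul] at this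

/-- Uniqueness of the capacitary potential. -/
lemma ae_eq_of_isCapacitaryPotential (H : IsKernel gl gu g) (hd : 0 < d)
    (hΩb : Bornology.IsBounded Ω) (h_test : ∀ φ, IsTest Ω φ → MemW g s φ) {u v : Space d → ℝ}
    (hu : IsCapacitaryPotential g s Ω E u) (hv : IsCapacitaryPotential g s Ω E v) :
    u =ᵐ[volume] v := by
  refine ae_eq_of_pairQuot (s := s) hd hΩb (H.ae_eq_zero_of_memW0 h_test hu.1.1)
    (H.ae_eq_zero_of_memW0 h_test hv.1.1) ?_
  have huW := hu.1.memW
  have hvW := hv.1.memW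
  have i1 := H.integrable_integrandL huW (H.memW_sub hvW huW)
  have i2 := H.integrable_integrandL hvW (H.memW_sub huW hvW)
  -- Each potential is tested against the other. The sum of the two integrands is pointwise
  -- non-positive by monotonicity of the field, so it vanishes a.e., and injectivity of the field
  -- identifies the quotients.
  have h1 : 0 ≤ ∫ z, (integrandL g s u (fun x => v x - u x) z +
      integrandL g s v (fun x => u x - v x) z) := by
    rw [integral_add i1 i2]
    exact add_nonneg (hu.2 v hv.1) (hv.2 u hu.1)
  have hle : ∀ᵐ z : Space d × Space d, 0 ≤ -(integrandL g s u (fun x => v x - u x) z +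
      integrandL g s v (fun x => u x - v x) z) := by
    filter_upwards [H.frac.growth] with z hG
    have hm := (hG.strictMono_field H.frac.exponent_pos).monotone
    simp only [integrandL_eq, pairQuot_sub]
    rcases le_total (pairQuot s u z) (pairQuot s v z) with h | h
    · nlinarith [mul_nonneg (sub_nonneg.2 (hm h)) (sub_nonneg.2 h)]
    · nlinarith [mul_nonneg (sub_nonneg.2 (hm h)) (sub_nonneg.2 h)]
  have h2 : ∫ z, -(integrandL g s u (fun x => v x - u x) z +
      integrandL g s v (fun x => u x - v x) z) = 0 := by
    refine le_antisymm ?_ (integral_nonneg_of_ae hle)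
    rw [integral_neg]
    linarith
  rw [integral_eq_zero_iff_of_nonneg_ae hle (i1.add i2).neg] at h2
  filter_upwards [h2, H.frac.growth] with z hz hG
  have hm := hG.strictMono_field H.frac.exponent_pos
  simp only [integrandL_eq, pairQuot_sub, Pi.zero_apply] at hz
  have h3 : (field (fracField g z) (pairQuot s v z) - field (fracField g z) (pairQuot s u z)) *
      (pairQuot s v z - pairQuot s u z) = 0 := by linarith
  rcases mul_eq_zero.1 h3 with h4 | h4
  · exact (hm.injective (sub_eq_zero.1 h4)).symm
  · exact (sub_eq_zero.1 h4).symm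

/-! ### Positivity of `𝓛u` and evaluation of the capacity. -/

/-- Non-negativity of `𝓛_g^s u` on limits of Lipschitz functions that are non-negative on `E`. -/
lemma pairingL_nonneg (H : IsKernel gl gu g) (hΩ : IsOpen Ω)
    (h_test : ∀ φ, IsTest Ω φ → MemW g s φ) (h_one : modularHat g (Ω.indicator 1) < ⊤)
    {u v : Space d → ℝ} (hu : IsCapacitaryPotential g s Ω E u) (hv : MemW g s v)
    {p : ℕ → Space d → ℝ} (hp : ∀ n, IsLipTest Ω (p n) ∧ ∀ x ∈ E, 0 ≤ p n x)
    (hpv : ModTendsto g s p v) : 0 ≤ pairingL g s u v := by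
  obtain ⟨w, hw, hwu⟩ := H.geOn_iff.1 hu.1.2
  have h1 := hwu.add H hpv (fun n => (hw n).1.continuous.measurable.aemeasurable) hu.1.memW.1
  -- The competitor is `u + v`, approximated by `w n + p n`, which is at least `1` on `E`.
  have h2 := hu.2 _ (H.memK_of_modTendsto hΩ h_test h_one (H.memW_add hu.1.memW hv)
    (fun n => ⟨(hw n).1.add (hp n).1, fun x hx => by linarith [(hw n).2 x hx, (hp n).2 x hx]⟩) h1)
  simpa using h2

/-- Test functions approximating `v` may change sign. Their positive parts are Lipschitz,
non-negative, and along a subsequence still converge to `max v 0 = v`; smoothness is lost, hence the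
use of Lipschitz functions in the constraint. -/
lemma pairingL_nonneg_of_nonneg (H : IsKernel gl gu g) (hΩ : IsOpen Ω)
    (h_test : ∀ φ, IsTest Ω φ → MemW g s φ) (h_one : modularHat g (Ω.indicator 1) < ⊤)
    {u v : Space d → ℝ} (hu : IsCapacitaryPotential g s Ω E u) (hv : MemW0 g s Ω v)
    (hv0 : ∀ᵐ x, 0 ≤ v x) : 0 ≤ pairingL g s u v := by
  obtain ⟨hvW, φ, hφ, hφv⟩ := H.memW0_iff.1 hv
  have hT : LipschitzWith 1 fun r : ℝ => max r 0 := LipschitzWith.id.max_const 0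
  obtain ⟨ns, -, hlim⟩ := hφv.exists_subseq_comp H (fun n => (h_test _ (hφ n)).1) hvW.1 hvW.2.2 hT
  refine H.pairingL_nonneg hΩ h_test h_one hu hvW (p := fun n x => max (φ (ns n) x) 0)
    (fun n => ⟨(hφ _).isLipTest.comp hT (max_self 0), fun x _ => le_max_right _ _⟩)
    (hlim.congr_right ?_)
  filter_upwards [hv0] with x hx
  exact max_eq_left hx

/-- The capacity is the pairing with any test function which equals `1` on `E`. -/
lemma pairingL_self_eq (H : IsKernel gl gu g) (hΩ : IsOpen Ω)
    (h_test : ∀ φ, IsTest Ω φ → MemW g s φ) (h_one : modularHat g (Ω.indicator 1) < ⊤)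
    {u χ : Space d → ℝ} (hu : IsCapacitaryPotential g s Ω E u) (hχ : IsTest Ω χ)
    (hχ1 : ∀ x ∈ E, χ x = 1) : pairingL g s u u = pairingL g s u χ := by
  have huW := hu.1.memW
  have hχW := h_test χ hχ
  have hsub : ∀ v v' : Space d → ℝ, MemW g s v → MemW g s v' →
      pairingL g s u (fun x => v x - v' x) = pairingL g s u v - pairingL g s u v' := by
    intro v v' hv hv'
    have := H.pairingL_add huW hv (H.memW_const_mul hv' (-1))
    rw [pairingL_const_mul] at this
    simpa [sub_eq_add_neg] using this
  have h1 : 0 ≤ pairingL g s u (fun x => χ x - u x) :=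
    hu.2 χ (H.memK_of_modTendsto hΩ h_test h_one hχW
      (fun _ => ⟨hχ.isLipTest, fun x hx => (hχ1 x hx).ge⟩) (ModTendsto.const χ))
  -- The approximants `w n - χ` of `u - χ` are non-negative on `E`, though not necessarily
  -- elsewhere.
  have h2 : 0 ≤ pairingL g s u (fun x => u x - χ x) := by
    obtain ⟨w, hw, hwu⟩ := H.geOn_iff.1 hu.1.2
    have h3 := hwu.add H ((ModTendsto.const χ).const_mul H (-1))
      (fun n => (hw n).1.continuous.measurable.aemeasurable) huW.1
    have e : (fun x => u x + -1 * χ x) = fun x => u x - χ x := by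
      funext x
      ring
    rw [e] at h3
    exact H.pairingL_nonneg hΩ h_test h_one hu (H.memW_sub huW hχW)
      (fun n => ⟨(hw n).1.add (hχ.isLipTest.const_mul _),
        fun x hx => by linarith [(hw n).2 x hx, hχ1 x hx]⟩) h3
  rw [hsub _ _ hχW huW] at h1
  rw [hsub _ _ huW hχW] at h2
  linarith

end IsKernel

/-! ### Representation by a measure carried by `E`. -/

open CompactlySupported in
/-- A linear functional on test functions which is non-negative on test functions that are
non-negative on the compact set `E` is represented by a Radon measure carried by `E`. -/
lemma exists_measure_of_nonneg_on {Ω E : Set (Space d)} (hΩ : IsOpen Ω) (hE : IsCompact E)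
    (hEΩ : E ⊆ Ω) (Λ : (Space d → ℝ) → ℝ)
    (hadd : ∀ φ ψ, IsTest Ω φ → IsTest Ω ψ → Λ (fun x => φ x + ψ x) = Λ φ + Λ ψ)
    (hsmul : ∀ (c : ℝ) φ, IsTest Ω φ → Λ (fun x => c * φ x) = c * Λ φ)
    (hpos : ∀ φ, IsTest Ω φ → (∀ x ∈ E, 0 ≤ φ x) → 0 ≤ Λ φ) :
    ∃ μ : Measure (Space d), μ.Regular ∧ (∀ φ, IsTest Ω φ → Λ φ = ∫ x, φ x ∂μ) ∧ μ Eᶜ = 0 := by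
  have hzero : IsTest Ω fun _ : Space d => (0 : ℝ) :=
    ⟨contDiff_const, HasCompactSupport.zero, by
      rw [show (fun _ : Space d => (0 : ℝ)) = 0 from rfl, tsupport_eq_empty_iff.2 rfl]
      exact empty_subset _⟩
  let D : Submodule ℝ C_c(Space d, ℝ) :=
    { carrier := {f | IsTest Ω f}
      add_mem' := fun hf hg => hf.add hg
      zero_mem' := hzero
      smul_mem' := fun c f hf => hf.smooth_mul (f := fun _ => c) contDiff_const }
  let F : C_c(Space d, ℝ) →ₗ.[ℝ] ℝ :=
    ⟨D, { toFun := fun f => Λ f.1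
          map_add' := fun f f' => hadd f.1 f'.1 f.2 f'.2
          map_smul' := fun c f => hsmul c f.1 f.2 }⟩
  -- The cone asks for non-negativity on `E` only. An extension positive on this larger cone both is
  -- a positive functional and ignores values off `E`.
  let P : PointedCone ℝ C_c(Space d, ℝ) :=
    { carrier := {f | ∀ x ∈ E, 0 ≤ f x}
      add_mem' := fun hf hg x hx => add_nonneg (hf x hx) (hg x hx)
      zero_mem' := fun _ _ => le_rfl
      smul_mem' := fun c f hf x hx => mul_nonneg c.2 (hf x hx) }
  obtain ⟨χ, hχ, hχ1, -⟩ := exists_isTest_eq_one hΩ hE hEΩ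
  -- The extension theorem requires every `f` to be moved into the cone by an element of the domain;
  -- `M χ` with `M` a bound for `|f|` does this, since `χ = 1` on `E`.
  obtain ⟨Φ, hΦF, hΦP⟩ := riesz_extension P F (fun f hf => hpos f.1 f.2 hf) fun f => by
    obtain ⟨M, hM⟩ := f.hasCompactSupport.exists_bound_of_continuous f.continuous
    have hMχ : IsTest Ω fun x => M * χ x := hχ.smooth_mul (f := fun _ => M) contDiff_const
    refine ⟨⟨⟨⟨fun x => M * χ x, hMχ.1.continuous⟩, hMχ.2.1⟩, hMχ⟩, fun x hx => ?_⟩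
    change 0 ≤ M * χ x + f x
    rw [hχ1 x hx, mul_one]
    have := (abs_le.1 (hM x)).1
    linarith
  let Ψ : C_c(Space d, ℝ) →ₚ[ℝ] ℝ :=
    PositiveLinearMap.mk₀ Φ fun f hf => hΦP f fun x _ => hf x
  have hreg : (RealRMK.rieszMeasure Ψ).Regular := inferInstance
  refine ⟨RealRMK.rieszMeasure Ψ, hreg, fun φ hφ => ?_, ?_⟩
  · have h1 := hΦF ⟨⟨⟨φ, hφ.1.continuous⟩, hφ.2.1⟩, hφ⟩
    have h2 := RealRMK.integral_rieszMeasure Ψ ⟨⟨φ, hφ.1.continuous⟩, hφ.2.1⟩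
    exact h1.symm.trans h2.symm
  · rw [hE.isClosed.isOpen_compl.measure_eq_iSup_isCompact]
    simp only [ENNReal.iSup_eq_zero]
    intro K hKE hK
    obtain ⟨η, hη, hη1, hη0⟩ := exists_isTest_eq_one hE.isClosed.isOpen_compl hK hKE
    have h1 := RealRMK.rieszMeasure_le_of_eq_one Ψ (f := ⟨⟨η, hη.1.continuous⟩, hη.2.1⟩)
      (fun x => (hη0 x).1) hK hη1
    -- Since `η` vanishes on `E`, also `-η` is in the cone, so `Φ η ≤ 0` while `μ K ≤ Φ η`. Inner
    -- regularity on the open set `Eᶜ` then gives `μ Eᶜ = 0`.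
    have h2 : 0 ≤ Φ (-⟨⟨η, hη.1.continuous⟩, hη.2.1⟩) := hΦP _ fun x hx => by
      change 0 ≤ -η x
      rw [hη.isLipTest.eq_zero (not_not.2 hx), neg_zero]
    rw [map_neg] at h2
    refine le_antisymm (h1.trans ?_) zero_le
    exact (ENNReal.ofReal_eq_zero.2 (neg_nonneg.1 h2)).le

end FracOrlicz

end

/-! ### The main theorem. -/

theorem mainTheorem9 {d : ℕ} (hd : 0 < d) {s : ℝ} (hs0 : 0 < s) (hs1 : s < 1)
    {gl gu : ℝ} (hgl : 0 < gl)
    (g : FracOrlicz.Space d → FracOrlicz.Space d → ℝ → ℝ)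
    (hg_meas : Measurable
      (fun p : FracOrlicz.Space d × FracOrlicz.Space d × ℝ => g p.1 p.2.1 p.2.2))
    (hg : ∀ᵐ z : FracOrlicz.Space d × FracOrlicz.Space d,
      FracOrlicz.IsAdmissible gl gu (g z.1 z.2))
    (hg_diag : ∀ᵐ x : FracOrlicz.Space d, FracOrlicz.IsAdmissible gl gu (g x x))
    (Ω : Set (FracOrlicz.Space d)) (hΩ_open : IsOpen Ω) (hΩ_bdd : Bornology.IsBounded Ω)
    (h_test : ∀ φ, FracOrlicz.IsTest Ω φ → FracOrlicz.MemW g s φ)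
    (h_one : FracOrlicz.modularHat g (Ω.indicator 1) < ⊤)
    (E : Set (FracOrlicz.Space d)) (hE : IsCompact E) (hEΩ : E ⊆ Ω) :
    (∀ u v, FracOrlicz.MemW0 g s Ω u → FracOrlicz.MemW0 g s Ω v →
      Integrable (FracOrlicz.integrandL g s u v)) ∧
    (∃ u, FracOrlicz.IsCapacitaryPotential g s Ω E u) ∧
    (∀ u v, FracOrlicz.IsCapacitaryPotential g s Ω E u →
      FracOrlicz.IsCapacitaryPotential g s Ω E v → u =ᵐ[volume] v) ∧
    ∀ u, FracOrlicz.IsCapacitaryPotential g s Ω E u →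
      FracOrlicz.EqOn g s Ω E u 1 ∧
      (∀ v, FracOrlicz.MemW0 g s Ω v → (∀ᵐ x, 0 ≤ v x) → 0 ≤ FracOrlicz.pairingL g s u v) ∧
      ∃ μ : Measure (FracOrlicz.Space d), μ.Regular ∧
        (∀ φ, FracOrlicz.IsTest Ω φ → FracOrlicz.pairingL g s u φ = ∫ x, φ x ∂μ) ∧
        μ.support ⊆ E ∧
        FracOrlicz.capacity g s Ω E = FracOrlicz.pairingL g s u u ∧
        FracOrlicz.pairingL g s u u = μ.real Ω ∧
        μ.real Ω = μ.real E := by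
  have H := FracOrlicz.IsKernel.of_isAdmissible hd hgl hg_meas hg hg_diag
  have huniq : ∀ u v, FracOrlicz.IsCapacitaryPotential g s Ω E u →
      FracOrlicz.IsCapacitaryPotential g s Ω E v → u =ᵐ[volume] v := fun u v hu hv =>
    H.ae_eq_of_isCapacitaryPotential hd hΩ_bdd h_test hu hv
  obtain ⟨u₀, hu₀W, ⟨w, hw, hwu⟩, hmin⟩ :=
    H.exists_minimizer hd hΩ_open hΩ_bdd h_test h_one hE hEΩ
  have hu₀ : FracOrlicz.IsCapacitaryPotential g s Ω E u₀ :=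
    H.isCapacitaryPotential_of_minimizer hΩ_open h_test h_one
      (H.memK_of_modTendsto hΩ_open h_test h_one hu₀W
        (fun n => ⟨(hw n).1, fun x hx => ((hw n).2 x hx).ge⟩) hwu) hmin
  refine ⟨fun u v hu hv => H.integrable_integrandL hu.1 hv.1, ⟨u₀, hu₀⟩, huniq, fun u hu => ?_⟩
  -- The approximants of the minimizer equal `1` on `E`, so by uniqueness the same sequence
  -- witnesses both one-sided conditions for any potential `u`.
  have hwu' := hwu.congr_right (huniq u₀ u hu₀ hu)
  refine ⟨⟨H.geOn_iff.2 ⟨w, fun n => ⟨(hw n).1, fun x hx => ((hw n).2 x hx).ge⟩, hwu'⟩,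
    H.leOn_iff.2 ⟨w, fun n => ⟨(hw n).1, fun x hx => ((hw n).2 x hx).le⟩, hwu'⟩⟩,
    fun v hv hv0 => H.pairingL_nonneg_of_nonneg hΩ_open h_test h_one hu hv hv0, ?_⟩
  obtain ⟨μ, hμ, hμφ, hμE⟩ := FracOrlicz.exists_measure_of_nonneg_on hΩ_open hE hEΩ
    (FracOrlicz.pairingL g s u)
    (fun φ ψ hφ hψ => H.pairingL_add hu.1.memW (h_test φ hφ) (h_test ψ hψ))
    (fun c φ _ => FracOrlicz.IsKernel.pairingL_const_mul u φ c)
    (fun φ hφ hφE => H.pairingL_nonneg hΩ_open h_test h_one hu (h_test φ hφ)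
      (fun _ => ⟨hφ.isLipTest, hφE⟩) (FracOrlicz.ModTendsto.const φ))
  obtain ⟨χ, hχ, hχ1, -⟩ := FracOrlicz.exists_isTest_eq_one hΩ_open hE hEΩ
  have hEae : ∀ᵐ x ∂μ, x ∈ E := by
    rw [ae_iff]
    exact hμE
  have hΩE : μ.real Ω = μ.real E := by
    refine measureReal_congr ?_
    filter_upwards [hEae] with x hx
    exact propext ⟨fun _ => hx, fun _ => hEΩ hx⟩
  refine ⟨μ, hμ, hμφ, Measure.support_subset_of_isClosed hE.isClosed hEae, ?_, ?_, hΩE⟩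
  · have hex : ∃ u, FracOrlicz.IsCapacitaryPotential g s Ω E u := ⟨u, hu⟩
    -- The capacity is defined through a chosen potential; a.e. uniqueness makes the choice
    -- immaterial.
    have hcu := huniq _ _ hex.choose_spec hu
    rw [FracOrlicz.capacity, dif_pos hex]
    exact FracOrlicz.IsKernel.pairingL_congr hcu hcu
  · rw [H.pairingL_self_eq hΩ_open h_test h_one hu hχ hχ1, hμφ χ hχ, hΩE]
    have h1 : ∫ x, χ x ∂μ = ∫ x, E.indicator (fun _ => (1 : ℝ)) x ∂μ := by
      refine integral_congr_ae ?_
      filter_upwards [hEae] with x hx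
      rw [indicator_of_mem hx, hχ1 x hx]
    rw [h1, integral_indicator_const _ hE.measurableSet, smul_eq_mul, mul_one]
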